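/- Let $n,m\ge 1$ be integers and $p\in(2,\infty)$. For $f\in L^2_{loc}(\mathbb R^n)$ (complex-valued) define the polynomial sharp function $$f^{\#,m}(x)=\sup_{B\ni x}\ \inf_{P\in\mathcal P_{m-1}}\left(\frac{1}{|B|}\int_B|f(y)-P(y)|^2\,dy\right)^{1/2},\qquad x\in\mathbb R^n,$$ where the supremum is taken over all open balls $B\subseteq\mathbb R^n$ that contain $x$, and $\mathcal P_{m-1}$ is the space of polynomials on $\mathbb R^n$ with complex coefficients and of degree less than $m$. Let $L^p_m(\mathbb R^n)$ be the space of all $f\in L^2_{loc}(\mathbb R^n)$ with $\|f\|_{L^p_m}:=\|f^{\#,m}\|_{L^p(\mathbb R^n)}<\infty$. Then there is a constant $C>0$, depending only on $n$, $m$ and $p$, such that for every $f\in L^p_m(\mathbb R^n)$ there exists a unique polynomial $P\in\mathcal P_{m-1}$ with $f-P\in L^p(\mathbb R^n)$, and this $P$ satisfies $$C^{-1}\,\|f\|_{L^p_m}\le\|f-P\|_{L^p(\mathbb R^n)}\le C\,\|f\|_{L^p_m}.$$ -/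

import Mathlib

open MeasureTheory
open scoped ENNReal

noncomputable section

/-- The value at `x ∈ ℝⁿ` of a polynomial in `n` variables with complex coefficients. -/
def polyFun {n : ℕ} (P : MvPolynomial (Fin n) ℂ) (x : EuclideanSpace ℝ (Fin n)) : ℂ :=
  MvPolynomial.eval (fun i => (x i : ℂ)) P

/-- `f ∈ L²_loc(ℝⁿ)`: `f` is square integrable on every compact set. -/
def IsL2Loc {n : ℕ} (f : EuclideanSpace ℝ (Fin n) → ℂ) : Prop :=
  ∀ K : Set (EuclideanSpace ℝ (Fin n)), IsCompact K → MemLp f 2 (volume.restrict K)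

/-- The distance of `f` to the polynomials of degree less than `m`, in the
normalized `L²` norm of the open ball `B(c, r)`. -/
def polyOscillation {n : ℕ} (m : ℕ) (f : EuclideanSpace ℝ (Fin n) → ℂ)
    (c : EuclideanSpace ℝ (Fin n)) (r : ℝ) : ℝ≥0∞ :=
  ⨅ (P : MvPolynomial (Fin n) ℂ) (_ : P.totalDegree < m),
    (⨍⁻ y in Metric.ball c r, ‖f y - polyFun P y‖ₑ ^ 2 ∂volume) ^ (1 / 2 : ℝ)

/-- The polynomial sharp function `f^{#,m}(x)`: the supremum of the oscillation over all
open balls `B` that contain `x`. -/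
def polySharp {n : ℕ} (m : ℕ) (f : EuclideanSpace ℝ (Fin n) → ℂ)
    (x : EuclideanSpace ℝ (Fin n)) : ℝ≥0∞ :=
  ⨆ (c : EuclideanSpace ℝ (Fin n)) (r : ℝ) (_ : 0 < r) (_ : x ∈ Metric.ball c r),
    polyOscillation m f c r

/-- The seminorm `‖f‖_{L^p_m} = ‖f^{#,m}‖_{L^p(ℝⁿ)}`, with values in `[0, ∞]`. -/
def polyLpNorm {n : ℕ} (p : ℝ) (m : ℕ) (f : EuclideanSpace ℝ (Fin n) → ℂ) : ℝ≥0∞ :=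
  eLpNorm (polySharp m f) (ENNReal.ofReal p) volume

/-- Membership in the polynomial `L^p` space `L^p_m(ℝⁿ)`. -/
def MemPolyLp {n : ℕ} (p : ℝ) (m : ℕ) (f : EuclideanSpace ℝ (Fin n) → ℂ) : Prop :=
  IsL2Loc f ∧ polyLpNorm p m f < ∞

end

/-! The lower bound is soft. Testing the infimum with `P` gives `f^# ≤ (M|f - P|²)^{1/2}`, where `M`
is the Hardy–Littlewood maximal operator, and `M` is bounded on `L^{p/2}` because `p/2 > 1`
(`exists_lintegral_polySharp_rpow_le`).

For the upper bound, choose on each dyadic cube a best `L²` approximation of `f` over a ball of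
comparable size. Fix a starting generation `k` and let `A_i` be the running maximum of the
difference between the approximations of generations `k + j`, `j ≤ i`, and that of generation `k`.
On each cube of generation `k + i + 1`, the mean of `A_N - A_i` is at most a constant times the mean
of `f^#`, by the `L²` maximal inequality applied to a localized `|f - P_{k+i}|`. A lemma of Garsia
type (`lintegral_rpow_le_of_fiberwise_increment_le`) turns this into `‖A_N‖_p ≤ C ‖f^#‖_p`. Lebesgue
differentiation then gives `‖f - P_k‖_p ≤ C ‖f^#‖_p` with `C` independent of `k`
(`exists_lintegral_sub_dyadicApprox_rpow_le`).

Now let `k → -∞`. Since `f^#` dominates the oscillation over a ball at every point of that ball,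
`f^# ∈ L^p` forces the oscillation over large balls to decay geometrically. Hence the piecewise
approximations converge pointwise to a single polynomial (`exists_tendsto_dyadicApprox`), and
Fatou's lemma preserves the bound. The limit is unique because a nonzero polynomial is not in `L^p`
(`eq_zero_of_lintegral_polyFun_rpow_ne_top`). -/

/-! ### The Hardy–Littlewood maximal function -/

-- A ball that witnesses a lower bound at `x` is open, so it witnesses the same bound at nearby
-- points. This makes sharp and maximal functions Borel with no assumption on `F`.
open Metric Set Filter Topology in
theorem lowerSemicontinuous_iSup_ball {X : Type*} [PseudoMetricSpace X] (F : X → ℝ → ℝ≥0∞) :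
    LowerSemicontinuous fun x : X =>
      ⨆ (c : X) (r : ℝ) (_ : 0 < r) (_ : x ∈ Metric.ball c r), F c r := by
  intro x t ht
  simp only [lt_iSup_iff] at ht
  obtain ⟨c, r, hr, hx, ht⟩ := ht
  filter_upwards [isOpen_ball.mem_nhds hx] with y hy
  simp only [lt_iSup_iff]
  exact ⟨c, r, hr, hy, ht⟩

theorem measurable_polySharp {n : ℕ} (m : ℕ) (f : EuclideanSpace ℝ (Fin n) → ℂ) :
    Measurable (polySharp m f) :=
  (lowerSemicontinuous_iSup_ball (polyOscillation m f)).measurable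

/-- The uncentered Hardy–Littlewood maximal function over open balls. -/
noncomputable def maximalFn {n : ℕ} (g : EuclideanSpace ℝ (Fin n) → ℝ≥0∞)
    (x : EuclideanSpace ℝ (Fin n)) : ℝ≥0∞ :=
  ⨆ (c : EuclideanSpace ℝ (Fin n)) (r : ℝ) (_ : 0 < r) (_ : x ∈ Metric.ball c r),
    ⨍⁻ y in Metric.ball c r, g y ∂volume

theorem measurable_maximalFn {n : ℕ} (g : EuclideanSpace ℝ (Fin n) → ℝ≥0∞) :
    Measurable (maximalFn g) :=
  (lowerSemicontinuous_iSup_ball fun c r => ⨍⁻ y in Metric.ball c r, g y ∂volume).measurable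

theorem laverage_ball_le_maximalFn {n : ℕ} (g : EuclideanSpace ℝ (Fin n) → ℝ≥0∞)
    {c x : EuclideanSpace ℝ (Fin n)} {r : ℝ} (hr : 0 < r) (hx : x ∈ Metric.ball c r) :
    ⨍⁻ y in Metric.ball c r, g y ∂volume ≤ maximalFn g x :=
  le_iSup₂_of_le c r (le_iSup₂_of_le hr hx le_rfl)

theorem maximalFn_congr_ae {n : ℕ} {g g' : EuclideanSpace ℝ (Fin n) → ℝ≥0∞}
    (h : g =ᵐ[volume] g') : maximalFn g = maximalFn g' := by
  funext x
  unfold maximalFn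
  simp only [laverage_congr (ae_restrict_of_ae h)]

theorem volume_ball_eq {n : ℕ} (c : EuclideanSpace ℝ (Fin n)) {r : ℝ} (hr : 0 < r) :
    volume (Metric.ball c r)
      = ENNReal.ofReal (r ^ n) * volume (Metric.ball (0 : EuclideanSpace ℝ (Fin n)) 1) := by
  have := Measure.addHaar_ball_of_pos (volume : Measure (EuclideanSpace ℝ (Fin n))) c hr
  simpa using this

theorem volume_closedBall_eq {n : ℕ} (c : EuclideanSpace ℝ (Fin n)) {r : ℝ} (hr : 0 ≤ r) :
    volume (Metric.closedBall c r)
      = ENNReal.ofReal (r ^ n) * volume (Metric.ball (0 : EuclideanSpace ℝ (Fin n)) 1) := by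
  have := Measure.addHaar_closedBall (volume : Measure (EuclideanSpace ℝ (Fin n))) c hr
  simpa using this

theorem volume_ball_ne_zero {n : ℕ} (c : EuclideanSpace ℝ (Fin n)) {r : ℝ} (hr : 0 < r) :
    volume (Metric.ball c r) ≠ 0 := (Metric.measure_ball_pos volume c hr).ne'

theorem volume_ball_ne_top {n : ℕ} (c : EuclideanSpace ℝ (Fin n)) (r : ℝ) :
    volume (Metric.ball c r) ≠ ∞ := measure_ball_lt_top.ne

theorem volume_ball_mul {n : ℕ} (c c' : EuclideanSpace ℝ (Fin n)) {r k : ℝ} (hr : 0 < r)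
    (hk : 0 < k) :
    volume (Metric.ball c (k * r)) = ENNReal.ofReal (k ^ n) * volume (Metric.ball c' r) := by
  rw [volume_ball_eq c (mul_pos hk hr), volume_ball_eq c' hr, mul_pow,
    ENNReal.ofReal_mul (by positivity), mul_assoc]

open Metric Set in
/-- The weak type `(1, 1)` bound for the maximal function. -/
theorem mul_volume_lt_maximalFn_le {n : ℕ} (hn : 1 ≤ n) (g : EuclideanSpace ℝ (Fin n) → ℝ≥0∞)
    (t : ℝ≥0∞) :
    t * volume {x | t < maximalFn g x} ≤ ENNReal.ofReal (4 ^ n) * ∫⁻ x, g x := by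
  rcases eq_or_ne t 0 with rfl | ht0
  · simp
  rcases eq_or_ne t ∞ with rfl | htt
  · simp
  rcases eq_or_ne (∫⁻ x, g x) ∞ with hg | hg
  · rw [hg, ENNReal.mul_top (by simp)]; exact le_top
  set V := volume (ball (0 : EuclideanSpace ℝ (Fin n)) 1) with hV
  have hV0 : V ≠ 0 := volume_ball_ne_zero _ one_pos
  have hVt : V ≠ ∞ := volume_ball_ne_top _ _
  let T : Set (EuclideanSpace ℝ (Fin n) × ℝ) :=
    {b | 0 < b.2 ∧ t * volume (ball b.1 b.2) ≤ ∫⁻ y in ball b.1 b.2, g y}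
  -- Vitali's lemma needs bounded radii: the finite integral bounds `r ^ n`, and `r ≤ r ^ n` once `r
  -- ≥ 1`.
  have hbound : ∀ b ∈ T, b.2 ≤ max 1 ((∫⁻ x, g x) / (t * V)).toReal := by
    rintro ⟨c, r⟩ ⟨hr, h⟩
    rcases le_total r 1 with h1 | h1
    · exact le_max_of_le_left h1
    refine le_max_of_le_right ?_
    have h2 : r ≤ r ^ n := le_self_pow₀ h1 (by omega)
    refine h2.trans ?_
    have h3 : ENNReal.ofReal (r ^ n) ≤ (∫⁻ x, g x) / (t * V) := by
      rw [ENNReal.le_div_iff_mul_le (Or.inl (by simp [ht0, hV0]))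
        (Or.inl (ENNReal.mul_ne_top htt hVt))]
      calc ENNReal.ofReal (r ^ n) * (t * V) = t * volume (ball c r) := by
            rw [volume_ball_eq c hr]; ring
        _ ≤ _ := h.trans (setLIntegral_le_lintegral _ _)
    exact (ENNReal.ofReal_le_iff_le_toReal
      (ENNReal.div_ne_top hg (by simp [ht0, hV0]))).1 h3
  -- Any enlargement factor above `3` is allowed; the choice `4` produces the constant `4 ^ n`.
  obtain ⟨u, huT, hdisj, hcov⟩ := Vitali.exists_disjoint_subfamily_covering_enlargement_closedBall
    T Prod.fst Prod.snd _ hbound 4 (by norm_num)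
  have hdisj' : u.PairwiseDisjoint fun b => ball b.1 b.2 :=
    hdisj.mono fun b => ball_subset_closedBall
  have hu : u.Countable := hdisj'.countable_of_isOpen (fun _ _ => isOpen_ball)
    fun b hb => nonempty_ball.2 (huT hb).1
  have hsub : {x | t < maximalFn g x} ⊆ ⋃ b ∈ u, closedBall b.1 (4 * b.2) := by
    intro x hx
    simp only [maximalFn, mem_ofPred_eq, lt_iSup_iff] at hx
    obtain ⟨c, r, hr, hxc, h⟩ := hx
    have hb : (c, r) ∈ T := by
      refine ⟨hr, ?_⟩
      rw [setLAverage_eq] at h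
      exact ENNReal.mul_le_of_le_div h.le
    obtain ⟨b, hbu, hsub⟩ := hcov _ hb
    exact mem_biUnion hbu (hsub (ball_subset_closedBall hxc))
  calc t * volume {x | t < maximalFn g x}
      ≤ t * ∑' b : u, volume (closedBall b.1.1 (4 * b.1.2)) := by
        gcongr
        exact (measure_mono hsub).trans (measure_biUnion_le _ hu _)
    _ = ∑' b : u, ENNReal.ofReal (4 ^ n) * (t * volume (ball b.1.1 b.1.2)) := by
        rw [← ENNReal.tsum_mul_left]
        refine tsum_congr fun b => ?_
        have hb := (huT b.2).1
        rw [volume_closedBall_eq _ (by positivity), volume_ball_eq _ hb, mul_pow,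
          ENNReal.ofReal_mul (by positivity)]
        ring
    _ ≤ ENNReal.ofReal (4 ^ n) * ∑' b : u, ∫⁻ y in ball b.1.1 b.1.2, g y := by
        rw [ENNReal.tsum_mul_left]
        gcongr with b
        exact (huT b.2).2
    _ = ENNReal.ofReal (4 ^ n) * ∫⁻ y in ⋃ b ∈ u, ball b.1 b.2, g y := by
        rw [lintegral_biUnion hu (fun _ _ => measurableSet_ball) hdisj']
    _ ≤ _ := mul_le_mul_right (setLIntegral_le_lintegral _ _) _

/-- The layer cake formula for powers of a single extended nonnegative number. -/
theorem lintegral_Ioi_indicator_rpow {s : ℝ} (hs : 0 < s) (a : ℝ≥0∞) :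
    ENNReal.ofReal s * ∫⁻ t in Set.Ioi (0 : ℝ),
      {t : ℝ | ENNReal.ofReal t < a}.indicator (fun t => ENNReal.ofReal (t ^ (s - 1))) t
      = a ^ s := by
  have hfin : ∀ b : ℝ, 0 ≤ b → ENNReal.ofReal s * ∫⁻ t in Set.Ioi (0 : ℝ),
      {t : ℝ | ENNReal.ofReal t < ENNReal.ofReal b}.indicator
        (fun t => ENNReal.ofReal (t ^ (s - 1))) t = ENNReal.ofReal b ^ s := by
    intro b hb
    -- For one finite number, this is the layer cake formula over a one-point probability space.
    have h := lintegral_rpow_eq_lintegral_meas_lt_mul (Measure.dirac ()) (f := fun _ => b)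
      (ae_of_all _ fun _ => hb) aemeasurable_const hs
    rw [lintegral_dirac] at h
    rw [ENNReal.ofReal_rpow_of_nonneg hb hs.le, h]
    congr 1
    refine setLIntegral_congr_fun measurableSet_Ioi fun t ht => ?_
    by_cases htb : t < b
    · simp [Set.indicator, ENNReal.ofReal_lt_ofReal_iff_of_nonneg (le_of_lt ht), htb]
    · simp [Set.indicator, ENNReal.ofReal_lt_ofReal_iff_of_nonneg (le_of_lt ht), htb]
  rcases eq_or_ne a ∞ with rfl | ha
  · rw [ENNReal.top_rpow_of_pos hs, eq_top_iff]
    refine le_of_tendsto' (f := fun k : ℕ => ENNReal.ofReal k ^ s) (x := Filter.atTop) ?_ ?_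
    · have h1 : Filter.Tendsto (fun k : ℕ => ENNReal.ofReal k) Filter.atTop (nhds ∞) := by
        simpa using ENNReal.tendsto_nat_nhds_top
      have := (ENNReal.continuous_rpow_const (y := s)).tendsto ∞ |>.comp h1
      rwa [ENNReal.top_rpow_of_pos hs] at this
    · intro k
      rw [← hfin k k.cast_nonneg]
      gcongr
      exact le_top
  · obtain ⟨b, hb, rfl⟩ : ∃ b : ℝ, 0 ≤ b ∧ a = ENNReal.ofReal b :=
      ⟨a.toReal, ENNReal.toReal_nonneg, (ENNReal.ofReal_toReal ha).symm⟩
    exact hfin b hb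

/-- The truncated weak type bound for the maximal function. -/
theorem volume_lt_maximalFn_le_truncated {n : ℕ} (hn : 1 ≤ n)
    {g : EuclideanSpace ℝ (Fin n) → ℝ≥0∞} (hg : Measurable g) {t : ℝ} (ht : 0 < t) :
    ENNReal.ofReal t * volume {x | ENNReal.ofReal t < maximalFn g x}
      ≤ ENNReal.ofReal (2 * 4 ^ n) * ∫⁻ x, {x | ENNReal.ofReal t < 2 * g x}.indicator g x := by
  set A := {x | ENNReal.ofReal t < 2 * g x} with hA
  have hmA : MeasurableSet A := measurableSet_lt measurable_const (hg.const_mul 2)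
  -- Off `A` one has `g ≤ t / 2`, so discarding that part lowers every average by at most `t / 2`.
  have hle : ∀ x, maximalFn g x ≤ maximalFn (A.indicator g) x + ENNReal.ofReal (t / 2) := by
    intro x
    refine iSup_le fun c => iSup_le fun r => iSup_le fun hr => iSup_le fun hx => ?_
    have hx' := laverage_ball_le_maximalFn (A.indicator g) hr hx
    refine le_trans ?_ (add_le_add_left hx' _)
    have h1 : ∀ y, g y ≤ A.indicator g y + ENNReal.ofReal (t / 2) := by
      intro y
      by_cases hy : y ∈ A
      · simp [hy]
      · simp only [hy, not_false_eq_true, Set.indicator_of_notMem, zero_add]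
        simp only [hA, Set.mem_ofPred_eq, not_lt] at hy
        rw [ENNReal.ofReal_div_of_pos two_pos, ENNReal.le_div_iff_mul_le (by simp) (by simp),
          mul_comm]
        simpa using hy
    calc ⨍⁻ y in Metric.ball c r, g y ∂volume
        ≤ ⨍⁻ y in Metric.ball c r, (A.indicator g y + ENNReal.ofReal (t / 2)) ∂volume := by
          simp only [setLAverage_eq]; gcongr; exact h1 _
      _ = _ := by
          simp only [setLAverage_eq]
          rw [lintegral_add_right _ measurable_const, ENNReal.add_div, setLIntegral_const,
            ENNReal.mul_div_cancel_right (volume_ball_ne_zero c hr) (volume_ball_ne_top c r)]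
  have hsub : {x | ENNReal.ofReal t < maximalFn g x}
      ⊆ {x | ENNReal.ofReal (t / 2) < maximalFn (A.indicator g) x} := by
    intro x hx
    simp only [Set.mem_ofPred_eq] at hx ⊢
    by_contra! h
    refine absurd (hx.trans_le ((hle x).trans (add_le_add_left h _))) ?_
    rw [← ENNReal.ofReal_add (by positivity) (by positivity), add_halves]
    exact lt_irrefl _
  have hw := mul_volume_lt_maximalFn_le hn (A.indicator g) (ENNReal.ofReal (t / 2))
  calc ENNReal.ofReal t * volume {x | ENNReal.ofReal t < maximalFn g x}
      ≤ ENNReal.ofReal 2 * (ENNReal.ofReal (t / 2)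
          * volume {x | ENNReal.ofReal (t / 2) < maximalFn (A.indicator g) x}) := by
        rw [← mul_assoc, ← ENNReal.ofReal_mul (by positivity), mul_div_cancel₀ _ two_ne_zero]
        gcongr
    _ ≤ _ := by
        rw [ENNReal.ofReal_mul two_pos.le, mul_assoc]
        gcongr

/-- The strong type `(q, q)` bound for the maximal function, `q > 1`. -/
theorem exists_lintegral_maximalFn_rpow_le {n : ℕ} (hn : 1 ≤ n) {q : ℝ} (hq : 1 < q) :
    ∃ C : ℝ≥0∞, C ≠ ∞ ∧ ∀ g : EuclideanSpace ℝ (Fin n) → ℝ≥0∞, AEMeasurable g →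
      ∫⁻ x, maximalFn g x ^ q ≤ C * ∫⁻ x, g x ^ q := by
  have hq0 : 0 < q := by linarith
  have hq1 : 0 < q - 1 := by linarith
  -- The factors come from the layer cake formula, the truncated weak bound, and the integral of `t
  -- ^ (q - 2)` over `0 < t < 2 g`.
  refine ⟨ENNReal.ofReal q * ENNReal.ofReal (2 * 4 ^ n) * (2 ^ (q - 1) / ENNReal.ofReal (q - 1)),
    ?_, ?_⟩
  · refine ENNReal.mul_ne_top (by finiteness) (ENNReal.div_ne_top ?_ (by simpa using hq))
    exact ENNReal.rpow_ne_top_of_nonneg hq1.le (by simp)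
  intro g₀ hg₀
  obtain ⟨g, hg, hgg⟩ := hg₀
  have hgq : ∫⁻ x, g₀ x ^ q = ∫⁻ x, g x ^ q :=
    lintegral_congr_ae (hgg.mono fun x hx => by simp only [hx])
  rw [maximalFn_congr_ae hgg, hgq]
  have hM := measurable_maximalFn g
  have meas1 : Measurable fun z : EuclideanSpace ℝ (Fin n) × ℝ =>
      {t : ℝ | ENNReal.ofReal t < maximalFn g z.1}.indicator
        (fun t => ENNReal.ofReal (t ^ (q - 1))) z.2 := by
    have : MeasurableSet {z : EuclideanSpace ℝ (Fin n) × ℝ |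
        ENNReal.ofReal z.2 < maximalFn g z.1} :=
      measurableSet_lt (by fun_prop) (hM.comp measurable_fst)
    exact Measurable.indicator (f := fun z : EuclideanSpace ℝ (Fin n) × ℝ =>
      ENNReal.ofReal (z.2 ^ (q - 1))) (by fun_prop) this
  have meas2 : Measurable fun z : EuclideanSpace ℝ (Fin n) × ℝ =>
      {t : ℝ | ENNReal.ofReal t < 2 * g z.1}.indicator
        (fun t => ENNReal.ofReal (t ^ (q - 1 - 1))) z.2 * g z.1 := by
    have : MeasurableSet {z : EuclideanSpace ℝ (Fin n) × ℝ |
        ENNReal.ofReal z.2 < 2 * g z.1} :=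
      measurableSet_lt (by fun_prop) (by fun_prop)
    exact (Measurable.indicator (f := fun z : EuclideanSpace ℝ (Fin n) × ℝ =>
      ENNReal.ofReal (z.2 ^ (q - 1 - 1))) (by fun_prop) this).mul (by fun_prop)
  calc ∫⁻ x, maximalFn g x ^ q
      = ∫⁻ x, ENNReal.ofReal q * ∫⁻ t in Set.Ioi (0 : ℝ),
          {t : ℝ | ENNReal.ofReal t < maximalFn g x}.indicator
            (fun t => ENNReal.ofReal (t ^ (q - 1))) t := by
        simp_rw [lintegral_Ioi_indicator_rpow hq0]
    _ = ENNReal.ofReal q * ∫⁻ x, ∫⁻ t in Set.Ioi (0 : ℝ),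
          {t : ℝ | ENNReal.ofReal t < maximalFn g x}.indicator
            (fun t => ENNReal.ofReal (t ^ (q - 1))) t :=
        lintegral_const_mul' _ _ ENNReal.ofReal_ne_top
    _ = ENNReal.ofReal q * ∫⁻ t in Set.Ioi (0 : ℝ), ∫⁻ x,
          {t : ℝ | ENNReal.ofReal t < maximalFn g x}.indicator
            (fun t => ENNReal.ofReal (t ^ (q - 1))) t := by
        rw [lintegral_lintegral_swap meas1.aemeasurable]
    _ ≤ ENNReal.ofReal q * ∫⁻ t in Set.Ioi (0 : ℝ), ENNReal.ofReal (2 * 4 ^ n) * ∫⁻ x,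
          {t : ℝ | ENNReal.ofReal t < 2 * g x}.indicator
            (fun t => ENNReal.ofReal (t ^ (q - 1 - 1))) t * g x := by
        gcongr ENNReal.ofReal q * ?_
        refine setLIntegral_mono' measurableSet_Ioi fun t ht => ?_
        have ht : 0 < t := ht
        have e1 : ∀ x, {t : ℝ | ENNReal.ofReal t < maximalFn g x}.indicator
            (fun t => ENNReal.ofReal (t ^ (q - 1))) t
            = ENNReal.ofReal (t ^ (q - 1)) *
              {x | ENNReal.ofReal t < maximalFn g x}.indicator 1 x := by
          intro x; simp [Set.indicator]
        have e2 : ∀ x, {t : ℝ | ENNReal.ofReal t < 2 * g x}.indicator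
            (fun t => ENNReal.ofReal (t ^ (q - 1 - 1))) t * g x
            = ENNReal.ofReal (t ^ (q - 1 - 1)) *
              {x | ENNReal.ofReal t < 2 * g x}.indicator g x := by
          intro x; simp [Set.indicator]
        simp_rw [e1, e2]
        rw [lintegral_const_mul' _ _ ENNReal.ofReal_ne_top,
          lintegral_const_mul' _ _ ENNReal.ofReal_ne_top,
          lintegral_indicator_one (measurableSet_lt measurable_const hM)]
        have := volume_lt_maximalFn_le_truncated hn hg ht
        calc ENNReal.ofReal (t ^ (q - 1)) * volume {x | ENNReal.ofReal t < maximalFn g x}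
            = ENNReal.ofReal (t ^ (q - 1 - 1)) *
              (ENNReal.ofReal t * volume {x | ENNReal.ofReal t < maximalFn g x}) := by
              rw [← mul_assoc, ← ENNReal.ofReal_mul (by positivity)]
              congr 2
              rw [Real.rpow_sub_one ht.ne' (q - 1), div_mul_cancel₀ _ ht.ne']
          _ ≤ _ := by
              rw [mul_left_comm (ENNReal.ofReal (2 * 4 ^ n))]
              gcongr
    _ = ENNReal.ofReal q * (ENNReal.ofReal (2 * 4 ^ n) * ∫⁻ x, ∫⁻ t in Set.Ioi (0 : ℝ),
          {t : ℝ | ENNReal.ofReal t < 2 * g x}.indicator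
            (fun t => ENNReal.ofReal (t ^ (q - 1 - 1))) t * g x) := by
        rw [lintegral_const_mul' _ _ ENNReal.ofReal_ne_top,
          ← lintegral_lintegral_swap meas2.aemeasurable]
    _ = ENNReal.ofReal q * (ENNReal.ofReal (2 * 4 ^ n) *
          ∫⁻ x, 2 ^ (q - 1) / ENNReal.ofReal (q - 1) * g x ^ q) := by
        congr 3
        funext x
        have hq1' : ENNReal.ofReal (q - 1) ≠ 0 := by simpa using hq
        rw [lintegral_mul_const _ (Measurable.indicator (by fun_prop)
          (measurableSet_lt (by fun_prop) measurable_const))]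
        have h := lintegral_Ioi_indicator_rpow hq1 (2 * g x)
        rw [mul_comm, ENNReal.mul_rpow_of_nonneg _ _ hq1.le] at h
        rw [ENNReal.eq_div_iff hq1' ENNReal.ofReal_ne_top |>.2 ((mul_comm _ _).trans h)]
        rw [div_eq_mul_inv, div_eq_mul_inv]
        have : g x ^ q = g x ^ (q - 1) * g x := by
          conv_lhs => rw [show q = (q - 1) + 1 by ring]
          rw [ENNReal.rpow_add_of_nonneg _ _ hq1.le zero_le_one, ENNReal.rpow_one]
        rw [this]; ring
    _ = _ := by
        rw [lintegral_const_mul _ (by fun_prop)]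
        ring

/-! ### Polynomials of bounded degree on balls -/

section PolyFun

variable {n : ℕ}

theorem polyFun_sub (P Q : MvPolynomial (Fin n) ℂ) (x : EuclideanSpace ℝ (Fin n)) :
    polyFun (P - Q) x = polyFun P x - polyFun Q x := by simp [polyFun]

theorem continuous_polyFun (P : MvPolynomial (Fin n) ℂ) : Continuous (polyFun P) := by
  unfold polyFun
  have : Continuous fun v : Fin n → ℂ => MvPolynomial.eval v P := MvPolynomial.continuous_eval P
  exact this.comp (by fun_prop)

theorem totalDegree_sub_lt {m : ℕ} {P Q : MvPolynomial (Fin n) ℂ} (hP : P.totalDegree < m)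
    (hQ : Q.totalDegree < m) : (P - Q).totalDegree < m :=
  (MvPolynomial.totalDegree_sub P Q).trans_lt (max_lt hP hQ)

/-- The ball contains a product of intervals, and a polynomial that vanishes on a product of
infinite sets is zero. -/
theorem eq_zero_of_polyFun_eq_zero_on_ball {P : MvPolynomial (Fin n) ℂ}
    {c : EuclideanSpace ℝ (Fin n)} {r : ℝ} (hr : 0 < r)
    (h : ∀ x ∈ Metric.ball c r, polyFun P x = 0) : P = 0 := by
  have hopen : IsOpen (WithLp.toLp 2 ⁻¹' Metric.ball c r : Set (Fin n → ℝ)) :=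
    Metric.isOpen_ball.preimage (PiLp.continuous_toLp 2 _)
  have hmem : WithLp.ofLp c ∈ (WithLp.toLp 2 ⁻¹' Metric.ball c r : Set (Fin n → ℝ)) := by
    simpa using hr
  obtain ⟨ε, hε, hsub⟩ := Metric.isOpen_iff.1 hopen _ hmem
  have hinf : ∀ i : Fin n, (Complex.ofReal '' Metric.ball (c i) ε).Infinite := fun i => by
    refine Set.Infinite.image (Complex.ofReal_injective.injOn) ?_
    rw [Real.ball_eq_Ioo]
    exact Set.Ioo_infinite (by linarith)
  refine MvPolynomial.funext_set (fun i => Complex.ofReal '' Metric.ball (c i) ε) hinf ?_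
  intro v hv
  choose w hw hwv using fun i => hv i (Set.mem_univ i)
  have hwb : w ∈ Metric.ball (WithLp.ofLp c) ε := by
    rw [ball_pi _ hε]; exact fun i _ => hw i
  have := h _ (hsub hwb)
  rw [map_zero, ← this, polyFun]
  congr 1
  congr 1
  exact funext fun i => (hwv i).symm

/-- The substitution `P ↦ P(c + r ·)`. -/
noncomputable def affineSubst (c : EuclideanSpace ℝ (Fin n)) (r : ℝ)
    (P : MvPolynomial (Fin n) ℂ) : MvPolynomial (Fin n) ℂ :=
  MvPolynomial.bind₁ (fun i => MvPolynomial.C (c i : ℂ) + MvPolynomial.C (r : ℂ) * MvPolynomial.X i)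
    P

theorem polyFun_affineSubst (c : EuclideanSpace ℝ (Fin n)) (r : ℝ) (P : MvPolynomial (Fin n) ℂ)
    (x : EuclideanSpace ℝ (Fin n)) : polyFun (affineSubst c r P) x = polyFun P (c + r • x) := by
  unfold polyFun affineSubst
  rw [← MvPolynomial.coe_aeval_eq_eval, RingHom.coe_coe, MvPolynomial.aeval_bind₁,
    ← MvPolynomial.coe_aeval_eq_eval, RingHom.coe_coe]
  simp

theorem totalDegree_affineSubst_le (c : EuclideanSpace ℝ (Fin n)) (r : ℝ)
    (P : MvPolynomial (Fin n) ℂ) : (affineSubst c r P).totalDegree ≤ P.totalDegree := by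
  unfold affineSubst
  rw [MvPolynomial.bind₁, MvPolynomial.aeval_def, MvPolynomial.eval₂_eq]
  refine MvPolynomial.totalDegree_finsetSum_le fun s hs => ?_
  refine (MvPolynomial.totalDegree_mul _ _).trans ?_
  have h1 : (algebraMap ℂ (MvPolynomial (Fin n) ℂ) (P.coeff s)).totalDegree = 0 :=
    MvPolynomial.totalDegree_C _
  rw [h1, zero_add]
  refine (MvPolynomial.totalDegree_finsetProd _ _).trans ?_
  refine le_trans ?_ (MvPolynomial.le_totalDegree hs)
  rw [Finsupp.sum]
  refine Finset.sum_le_sum fun i _ => (MvPolynomial.totalDegree_pow _ _).trans ?_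
  refine (Nat.mul_le_mul_left _ ?_).trans (mul_one _).le
  refine (MvPolynomial.totalDegree_add _ _).trans (max_le (by simp) ?_)
  refine (MvPolynomial.totalDegree_mul _ _).trans ?_
  simp

theorem memLp_polyFun_ball (q : ℝ≥0∞) (P : MvPolynomial (Fin n) ℂ)
    (c : EuclideanSpace ℝ (Fin n)) (r : ℝ) :
    MemLp (polyFun P) q (volume.restrict (Metric.ball c r)) := by
  have : IsFiniteMeasure (volume.restrict (Metric.ball c r)) :=
    ⟨by simpa using measure_ball_lt_top⟩
  obtain ⟨B, hB⟩ := (isCompact_closedBall c r).exists_bound_of_continuousOn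
    (continuous_polyFun P).continuousOn
  refine MemLp.of_bound (continuous_polyFun P).aestronglyMeasurable B ?_
  refine (ae_restrict_iff' measurableSet_ball).2 (ae_of_all _ fun x hx => ?_)
  exact hB x (Metric.ball_subset_closedBall hx)

/-- Polynomials as elements of `L^q` of a ball. -/
noncomputable def polyToLp (q : ℝ≥0∞) (c : EuclideanSpace ℝ (Fin n)) (r : ℝ) :
    MvPolynomial (Fin n) ℂ →ₗ[ℂ] Lp ℂ q (volume.restrict (Metric.ball c r)) where
  toFun P := (memLp_polyFun_ball q P c r).toLp
  map_add' P Q := by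
    rw [← MemLp.toLp_add]
    congr 1
    funext x
    simp [polyFun]
  map_smul' a P := by
    rw [RingHom.id_apply, ← MemLp.toLp_const_smul]
    congr 1
    funext x
    simp [polyFun]

theorem polyToLp_injective (q : ℝ≥0∞) (c : EuclideanSpace ℝ (Fin n)) {r : ℝ} (hr : 0 < r) :
    Function.Injective (polyToLp q c r) := by
  rw [← LinearMap.ker_eq_bot, LinearMap.ker_eq_bot']
  intro P hP
  have h : polyFun P =ᵐ[volume.restrict (Metric.ball c r)] 0 :=
    (MemLp.toLp_eq_toLp_iff (memLp_polyFun_ball q P c r) MemLp.zero').1 hP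
  refine eq_zero_of_polyFun_eq_zero_on_ball hr (c := c) fun x hx => ?_
  exact Measure.eqOn_open_of_ae_eq h Metric.isOpen_ball
    (continuous_polyFun P).continuousOn continuousOn_const hx

/-- An injective linear map from a finite-dimensional space is bounded below; here it is the map
into `L¹` of the unit ball. -/
theorem exists_coordinates (n m : ℕ) : ∃ (d : ℕ)
    (v : MvPolynomial.restrictTotalDegree (Fin n) ℂ m ≃ₗ[ℂ] (Fin d → ℂ)) (K : NNReal),
    ∀ P, ‖v P‖ₑ ≤ K * ∫⁻ y in Metric.ball 0 1, ‖polyFun (P : MvPolynomial (Fin n) ℂ) y‖ₑ := by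
  let V := MvPolynomial.restrictTotalDegree (Fin n) ℂ m
  let v := (Module.finBasis ℂ V).equivFun
  let T : (Fin _ → ℂ) →ₗ[ℂ] Lp ℂ 1 (volume.restrict (Metric.ball
      (0 : EuclideanSpace ℝ (Fin n)) 1)) :=
    (polyToLp 1 0 1).comp (V.subtype.comp v.symm.toLinearMap)
  have hT : LinearMap.ker T = ⊥ := by
    rw [LinearMap.ker_eq_bot]
    exact (polyToLp_injective 1 0 one_pos).comp (V.injective_subtype.comp v.symm.injective)
  obtain ⟨K, -, hK⟩ := LinearMap.exists_antilipschitzWith T hT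
  refine ⟨_, v, K, fun P => ?_⟩
  have h := hK (v P) 0
  rw [map_zero, edist_zero_right, edist_zero_right] at h
  have h2 : T (v P) = polyToLp 1 0 1 (P : MvPolynomial (Fin n) ℂ) := by simp [T, v, V]
  rw [h2] at h
  refine h.trans (le_of_eq ?_)
  congr 1
  change ‖(memLp_polyFun_ball 1 _ 0 1).toLp‖ₑ = _
  rw [Lp.enorm_toLp, eLpNorm_one_eq_lintegral_enorm]

/-- Summable `L¹` increments make the coordinates Cauchy, and evaluation at a point is continuous in
the coordinates. -/
theorem exists_tendsto_polyFun {m : ℕ} (P : ℕ → MvPolynomial (Fin n) ℂ)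
    (hP : ∀ k, (P k).totalDegree < m)
    (hsum : ∑' k, ∫⁻ y in Metric.ball 0 1, ‖polyFun (P (k + 1) - P k) y‖ₑ ≠ ∞) :
    ∃ Q : MvPolynomial (Fin n) ℂ, Q.totalDegree < m ∧
      ∀ x, Filter.Tendsto (fun k => polyFun (P k) x) Filter.atTop (nhds (polyFun Q x)) := by
  -- `restrictTotalDegree` bounds the degree non-strictly, hence `m - 1`.
  obtain ⟨d, v, K, hv⟩ := exists_coordinates n (m - 1)
  have hmem : ∀ k, P k ∈ MvPolynomial.restrictTotalDegree (Fin n) ℂ (m - 1) := fun k => by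
    rw [MvPolynomial.mem_restrictTotalDegree]; have := hP k; omega
  let P' : ℕ → MvPolynomial.restrictTotalDegree (Fin n) ℂ (m - 1) := fun k => ⟨P k, hmem k⟩
  have hcauchy : CauchySeq fun k => v (P' k) := by
    refine cauchySeq_of_edist_le_of_tsum_ne_top
      (fun k => K * ∫⁻ y in Metric.ball 0 1, ‖polyFun (P (k + 1) - P k) y‖ₑ) (fun k => ?_) ?_
    · rw [edist_comm, edist_eq_enorm_sub, ← map_sub]
      exact hv _
    · rw [ENNReal.tsum_mul_left]
      exact ENNReal.mul_ne_top ENNReal.coe_ne_top hsum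
  obtain ⟨w, hw⟩ := cauchySeq_tendsto_of_complete hcauchy
  refine ⟨v.symm w, ?_, fun x => ?_⟩
  · have := (MvPolynomial.mem_restrictTotalDegree _ _ _).1 (v.symm w).2
    have := hP 0
    omega
  · let L : (Fin d → ℂ) →ₗ[ℂ] ℂ :=
      (MvPolynomial.aeval (R := ℂ) (fun i => (x i : ℂ))).toLinearMap.comp
        ((Submodule.subtype _).comp v.symm.toLinearMap)
    have hL : Continuous L := L.continuous_of_finiteDimensional
    have := (hL.tendsto w).comp hw
    convert this using 2
    · simp [L, P', polyFun]
    · simp [L, polyFun]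

/-- The map from coordinates to continuous functions on the closed ball is bounded, since its source
is finite-dimensional. -/
theorem exists_enorm_polyFun_le_unit_ball (n m : ℕ) : ∃ C : ℝ≥0∞, C ≠ ∞ ∧
    ∀ P : MvPolynomial (Fin n) ℂ, P.totalDegree < m → ∀ y ∈ Metric.ball 0 1,
      ‖polyFun P y‖ₑ ≤ C * ∫⁻ y in Metric.ball 0 1, ‖polyFun P y‖ₑ := by
  obtain ⟨d, v, K, hv⟩ := exists_coordinates n (m - 1)
  let S : (Fin d → ℂ) →ₗ[ℂ] C(Metric.closedBall (0 : EuclideanSpace ℝ (Fin n)) 1, ℂ) :=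
    { toFun := fun w => ⟨fun y => polyFun (v.symm w : MvPolynomial (Fin n) ℂ) y,
        (continuous_polyFun _).comp continuous_subtype_val⟩
      map_add' := fun a b => by ext; simp [polyFun]
      map_smul' := fun a b => by ext; simp [polyFun] }
  let S' := LinearMap.toContinuousLinearMap S
  refine ⟨‖S'‖ₑ * K, ENNReal.mul_ne_top enorm_ne_top ENNReal.coe_ne_top, fun P hP y hy => ?_⟩
  have hmem : P ∈ MvPolynomial.restrictTotalDegree (Fin n) ℂ (m - 1) := by
    rw [MvPolynomial.mem_restrictTotalDegree]; omega
  have h1 : ‖polyFun P y‖ₑ ≤ ‖S' (v ⟨P, hmem⟩)‖ₑ := by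
    have h2 : S' (v ⟨P, hmem⟩) ⟨y, Metric.ball_subset_closedBall hy⟩ = polyFun P y := by
      simp [S', S]
    rw [← h2, enorm_le_iff_norm_le]
    exact ContinuousMap.norm_coe_le_norm _ _
  refine h1.trans ((S'.le_opENorm _).trans ?_)
  rw [mul_assoc]
  gcongr
  exact hv ⟨P, hmem⟩

theorem lintegral_unit_ball_comp_affine (F : EuclideanSpace ℝ (Fin n) → ℝ≥0∞) (hF : Measurable F)
    (c : EuclideanSpace ℝ (Fin n)) {r : ℝ} (hr : 0 < r) :
    ∫⁻ y in Metric.ball 0 1, F (c + r • y)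
      = (ENNReal.ofReal (r ^ n))⁻¹ * ∫⁻ y in Metric.ball c r, F y := by
  let G : EuclideanSpace ℝ (Fin n) → ℝ≥0∞ := fun w => (Metric.ball c r).indicator F (c + w)
  have hG : Measurable G := (hF.indicator measurableSet_ball).comp (measurable_const_add c)
  have h1 : ∫⁻ y in Metric.ball 0 1, F (c + r • y) = ∫⁻ y, G (r • y) := by
    rw [← lintegral_indicator measurableSet_ball]
    congr 1
    funext y
    have : y ∈ Metric.ball 0 1 ↔ c + r • y ∈ Metric.ball c r := by
      rw [mem_ball_zero_iff, mem_ball_iff_norm, add_sub_cancel_left, norm_smul,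
        Real.norm_of_nonneg hr.le]
      exact (mul_lt_iff_lt_one_right hr).symm
    by_cases hy : y ∈ Metric.ball 0 1
    · simp only [G, Set.indicator_of_mem hy, Set.indicator_of_mem (this.1 hy)]
    · simp only [G, Set.indicator_of_notMem hy, Set.indicator_of_notMem (mt this.2 hy)]
  have h2 : ∫⁻ y, G (r • y) = (ENNReal.ofReal (r ^ n))⁻¹ * ∫⁻ y, G y := by
    rw [← lintegral_map hG (measurable_const_smul r), Measure.map_addHaar_smul _ hr.ne',
      lintegral_smul_measure, finrank_euclideanSpace_fin, smul_eq_mul, abs_of_pos (by positivity),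
      ENNReal.ofReal_inv_of_pos (by positivity)]
  rw [h1, h2, lintegral_add_left_eq_self (fun w => (Metric.ball c r).indicator F w) c,
    lintegral_indicator measurableSet_ball]

/-- On polynomials of degree less than `m`, the sup norm over a ball is controlled by the
average over that ball. -/
theorem exists_enorm_polyFun_le_laverage (n m : ℕ) : ∃ C : ℝ≥0∞, C ≠ ∞ ∧
    ∀ P : MvPolynomial (Fin n) ℂ, P.totalDegree < m → ∀ c : EuclideanSpace ℝ (Fin n), ∀ r : ℝ,
      0 < r → ∀ y ∈ Metric.ball c r,
        ‖polyFun P y‖ₑ ≤ C * ⨍⁻ z in Metric.ball c r, ‖polyFun P z‖ₑ ∂volume := by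
  obtain ⟨C, hC, h⟩ := exists_enorm_polyFun_le_unit_ball n m
  refine ⟨C * volume (Metric.ball (0 : EuclideanSpace ℝ (Fin n)) 1),
    ENNReal.mul_ne_top hC (volume_ball_ne_top _ _), fun P hP c r hr y hy => ?_⟩
  -- Rescaling to the unit ball does not raise the degree, so one constant serves all balls.
  have hy' : r⁻¹ • (y - c) ∈ Metric.ball (0 : EuclideanSpace ℝ (Fin n)) 1 := by
    rw [mem_ball_zero_iff, norm_smul, norm_inv, Real.norm_of_nonneg hr.le,
      inv_mul_lt_iff₀ hr, mul_one]
    exact mem_ball_iff_norm.1 hy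
  have := h (affineSubst c r P) ((totalDegree_affineSubst_le c r P).trans_lt hP) _ hy'
  simp only [polyFun_affineSubst] at this
  rw [smul_inv_smul₀ hr.ne', add_sub_cancel,
    lintegral_unit_ball_comp_affine (fun y => ‖polyFun P y‖ₑ)
      (continuous_polyFun P).measurable.enorm c hr] at this
  refine this.trans (le_of_eq ?_)
  rw [setLAverage_eq, volume_ball_eq c hr, div_eq_mul_inv, ENNReal.mul_inv
    (Or.inr (volume_ball_ne_top _ _)) (Or.inr (volume_ball_ne_zero _ one_pos)), mul_assoc]
  congr 1
  have hV := ENNReal.mul_inv_cancel (volume_ball_ne_zero (0 : EuclideanSpace ℝ (Fin n)) one_pos)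
    (volume_ball_ne_top 0 1)
  set V := volume (Metric.ball (0 : EuclideanSpace ℝ (Fin n)) 1)
  set I := ∫⁻ y in Metric.ball c r, ‖polyFun P y‖ₑ
  calc _ = (V * V⁻¹) * ((ENNReal.ofReal (r ^ n))⁻¹ * I) := by rw [hV, one_mul]
    _ = _ := by ring

/-- The range is finite-dimensional, hence complete, so the orthogonal projection exists. -/
theorem exists_forall_norm_sub_le {V H : Type*} [AddCommGroup V] [Module ℂ V]
    [FiniteDimensional ℂ V] [NormedAddCommGroup H] [InnerProductSpace ℂ H] (T : V →ₗ[ℂ] H) (u : H) :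
    ∃ v, ∀ w, ‖u - T v‖ ≤ ‖u - T w‖ := by
  obtain ⟨_, ⟨v, rfl⟩, hv⟩ := (LinearMap.range T).exists_norm_eq_iInf_of_complete_subspace
    (LinearMap.range T).complete_of_finiteDimensional u
  refine ⟨v, fun w => ?_⟩
  rw [hv]
  exact ciInf_le (f := fun w : LinearMap.range T => ‖u - w‖)
    ⟨0, by rintro _ ⟨_, rfl⟩; exact norm_nonneg _⟩ ⟨T w, ⟨w, rfl⟩⟩

/-- The infimum defining the polynomial oscillation is attained. -/
theorem exists_laverage_le_polyOscillation {m : ℕ} (hm : 1 ≤ m)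
    {f : EuclideanSpace ℝ (Fin n) → ℂ} {c : EuclideanSpace ℝ (Fin n)} {r : ℝ}
    (hf : MemLp f 2 (volume.restrict (Metric.ball c r))) :
    ∃ P : MvPolynomial (Fin n) ℂ, P.totalDegree < m ∧
      (⨍⁻ y in Metric.ball c r, ‖f y - polyFun P y‖ₑ ^ 2 ∂volume) ^ (1 / 2 : ℝ)
        ≤ polyOscillation m f c r := by
  let V := MvPolynomial.restrictTotalDegree (Fin n) ℂ (m - 1)
  have hV : ∀ P, P ∈ V ↔ P.totalDegree < m := fun P => by
    rw [MvPolynomial.mem_restrictTotalDegree]; omega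
  let T := (polyToLp 2 c r).comp V.subtype
  obtain ⟨P, hPmin⟩ := exists_forall_norm_sub_le T hf.toLp
  have key : ∀ Q : V, ‖hf.toLp - T Q‖ₑ
      = (∫⁻ y in Metric.ball c r, ‖f y - polyFun (Q : MvPolynomial (Fin n) ℂ) y‖ₑ ^ 2)
        ^ (1 / 2 : ℝ) := by
    intro Q
    have : hf.toLp f - T Q = (hf.sub (memLp_polyFun_ball 2 (Q : MvPolynomial (Fin n) ℂ) c r)).toLp
        (f - polyFun (Q : MvPolynomial (Fin n) ℂ)) := by
      rw [MemLp.toLp_sub hf (memLp_polyFun_ball 2 (Q : MvPolynomial (Fin n) ℂ) c r)]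
      rfl
    rw [this, Lp.enorm_toLp, eLpNorm_eq_lintegral_rpow_enorm_toReal (by simp) (by simp)]
    simp
  refine ⟨P, (hV _).1 P.2, le_iInf₂ fun Q hQ => ?_⟩
  have h1 : ‖hf.toLp - T P‖ₑ ≤ ‖hf.toLp - T ⟨Q, (hV Q).2 hQ⟩‖ₑ := 
    enorm_le_iff_norm_le.2 (hPmin _)
  rw [key, key, ENNReal.rpow_le_rpow_iff (by norm_num)] at h1
  simp only [setLAverage_eq]
  gcongr

end PolyFun

/-! ### Increasing processes and Garsia's lemma -/

section IncreasingProcess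

/-- Discrete integration by parts. The terms with `a N` telescope to `a N ^ p`; by Young's
inequality the terms with `a i` sum to at most `(p - 1) / p * a N ^ p`. -/
theorem rpow_le_sum_mul_sub_real {p : ℝ} (hp : 1 < p) (a : ℕ → ℝ) (ha : ∀ i, 0 ≤ a i)
    (ha0 : a 0 = 0) (N : ℕ) :
    a N ^ p ≤ p * ∑ i ∈ Finset.range N, (a N - a i) * (a (i + 1) ^ (p - 1) - a i ^ (p - 1)) := by
  have hp0 : 0 < p := by linarith
  have hmul : ∀ b : ℝ, 0 ≤ b → b * b ^ (p - 1) = b ^ p := fun b hb => by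
    rcases hb.eq_or_lt with rfl | hb
    · rw [zero_mul, Real.zero_rpow hp0.ne']
    · rw [Real.rpow_sub_one hb.ne', mul_div_cancel₀ _ hb.ne']
  have hstep : ∀ i, a i * (a (i + 1) ^ (p - 1) - a i ^ (p - 1))
      ≤ (p - 1) / p * (a (i + 1) ^ p - a i ^ p) := by
    intro i
    have hconj : p.HolderConjugate (p / (p - 1)) := Real.HolderConjugate.conjExponent hp
    have hy := Real.young_inequality_of_nonneg (ha i) (Real.rpow_nonneg (ha (i + 1)) (p - 1)) hconj
    rw [← Real.rpow_mul (ha _), mul_div_cancel₀ _ (by linarith : p - 1 ≠ 0)] at hy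
    rw [mul_sub, hmul _ (ha i)]
    have h1 : a (i + 1) ^ p / (p / (p - 1)) = (p - 1) / p * a (i + 1) ^ p := by
      rw [div_div_eq_mul_div]; ring
    have h2 : a i ^ p / p = a i ^ p - (p - 1) / p * a i ^ p := by field_simp; ring
    rw [h1, h2] at hy
    linarith
  have hsum : ∑ i ∈ Finset.range N, a i * (a (i + 1) ^ (p - 1) - a i ^ (p - 1))
      ≤ (p - 1) / p * a N ^ p := by
    refine (Finset.sum_le_sum fun i _ => hstep i).trans (le_of_eq ?_)
    rw [← Finset.mul_sum, Finset.sum_range_sub (fun i => a i ^ p), ha0, Real.zero_rpow hp0.ne',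
      sub_zero]
  have htel : ∑ i ∈ Finset.range N, a N * (a (i + 1) ^ (p - 1) - a i ^ (p - 1)) = a N ^ p := by
    rw [← Finset.mul_sum, Finset.sum_range_sub (fun i => a i ^ (p - 1)), ha0,
      Real.zero_rpow (by linarith : p - 1 ≠ 0), sub_zero, hmul _ (ha N)]
  simp_rw [sub_mul]
  rw [Finset.sum_sub_distrib, htel]
  have h3 : p * ((p - 1) / p * a N ^ p) = (p - 1) * a N ^ p := by field_simp
  nlinarith [mul_le_mul_of_nonneg_left hsum hp0.le]

theorem rpow_le_sum_mul_sub {p : ℝ} (hp : 1 < p) {A : ℕ → ℝ≥0∞} (hA : Monotone A)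
    (hA0 : A 0 = 0) {N : ℕ} (hN : A N ≠ ∞) :
    A N ^ p ≤ ENNReal.ofReal p *
      ∑ i ∈ Finset.range N, (A N - A i) * (A (i + 1) ^ (p - 1) - A i ^ (p - 1)) := by
  have hq : 0 ≤ p - 1 := by linarith
  let a : ℕ → ℝ := fun i => (A i).toReal
  have ha : ∀ i, 0 ≤ a i := fun i => ENNReal.toReal_nonneg
  have hAa : ∀ i ≤ N, A i = ENNReal.ofReal (a i) := fun i hi =>
    (ENNReal.ofReal_toReal (ne_top_of_le_ne_top hN (hA hi))).symm
  have hmono : ∀ i j, i ≤ j → j ≤ N → a i ≤ a j := fun i j hij hj =>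
    ENNReal.toReal_mono (ne_top_of_le_ne_top hN (hA hj)) (hA hij)
  have h := rpow_le_sum_mul_sub_real hp a ha (by simp [a, hA0]) N
  have hsum : ∑ i ∈ Finset.range N, (A N - A i) * (A (i + 1) ^ (p - 1) - A i ^ (p - 1))
      = ENNReal.ofReal
        (∑ i ∈ Finset.range N, (a N - a i) * (a (i + 1) ^ (p - 1) - a i ^ (p - 1))) := by
    rw [ENNReal.ofReal_sum_of_nonneg]
    · refine Finset.sum_congr rfl fun i hi => ?_
      have hi := Finset.mem_range.1 hi
      rw [hAa N le_rfl, hAa i hi.le, hAa (i + 1) hi, ENNReal.ofReal_rpow_of_nonneg (ha _) hq,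
        ENNReal.ofReal_rpow_of_nonneg (ha _) hq, ← ENNReal.ofReal_sub _ (ha _),
        ← ENNReal.ofReal_sub _ (Real.rpow_nonneg (ha _) _),
        ENNReal.ofReal_mul (sub_nonneg.2 (hmono i N hi.le le_rfl))]
    · intro i hi
      have hi := Finset.mem_range.1 hi
      exact mul_nonneg (sub_nonneg.2 (hmono i N hi.le le_rfl))
        (sub_nonneg.2 (Real.rpow_le_rpow (ha _) (hmono i (i + 1) i.le_succ hi) hq))
  rw [hsum, hAa N le_rfl, ENNReal.ofReal_rpow_of_nonneg (ha _) (by linarith),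
    ← ENNReal.ofReal_mul (by linarith)]
  exact ENNReal.ofReal_le_ofReal h

theorem sum_range_tsub_of_monotone {B : ℕ → ℝ≥0∞} (hB : Monotone B) (hB0 : B 0 = 0) (N : ℕ) :
    ∑ i ∈ Finset.range N, (B (i + 1) - B i) = B N := by
  induction N with
  | zero => simp [hB0]
  | succ k ih => rw [Finset.sum_range_succ, ih, add_tsub_cancel_of_le (hB k.le_succ)]

/-- Either `2ch ≤ a` and the first term suffices, or `a ≤ 2ch` and the second does. The factor one
half is there to be absorbed. -/
theorem mul_mul_rpow_le {p : ℝ} (hp : 1 < p) (c h a : ℝ≥0∞) :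
    c * h * a ^ (p - 1) ≤ 2⁻¹ * a ^ p + (2 * c) ^ p * h ^ p := by
  have hq : 0 ≤ p - 1 := by linarith
  have hmul : ∀ b : ℝ≥0∞, b * b ^ (p - 1) = b ^ p := fun b => by
    conv_rhs => rw [show p = 1 + (p - 1) by ring]
    rw [ENNReal.rpow_add_of_nonneg _ _ zero_le_one hq, ENNReal.rpow_one]
  rcases le_total (2 * (c * h)) a with h1 | h1
  · refine le_add_right ?_
    rw [← hmul a, ← mul_assoc]
    refine mul_le_mul_left ?_ _
    rw [← one_mul (c * h), ← ENNReal.inv_mul_cancel two_ne_zero ENNReal.ofNat_ne_top, mul_assoc]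
    exact mul_le_mul_right h1 _
  · refine le_add_left ?_
    rw [← ENNReal.mul_rpow_of_nonneg _ _ (by linarith), mul_assoc 2 c h, ← hmul]
    refine mul_le_mul' ?_ (ENNReal.rpow_le_rpow h1 hq)
    rw [two_mul]
    exact le_self_add

variable {X ι : Type*} [MeasurableSpace X] {μ : Measure X} [Countable ι] [MeasurableSpace ι]
  [MeasurableSingletonClass ι]

/-- This replaces conditional expectation: on each of the countably many fibres the weight is a
constant and leaves the integral. -/
theorem lintegral_mul_le_of_fiberwise {d : X → ι} (hd : Measurable d) {w G H : X → ℝ≥0∞}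
    (hG : Measurable G) (hH : Measurable H) (hw : ∀ x y, d x = d y → w x = w y)
    (hGH : ∀ z, ∫⁻ x in d ⁻¹' {z}, G x ∂μ ≤ ∫⁻ x in d ⁻¹' {z}, H x ∂μ) :
    ∫⁻ x, w x * G x ∂μ ≤ ∫⁻ x, w x * H x ∂μ := by
  have hm : ∀ z, MeasurableSet (d ⁻¹' {z}) := fun z => hd (measurableSet_singleton z)
  have hsplit : ∀ F : X → ℝ≥0∞, ∫⁻ x, F x ∂μ = ∑' z, ∫⁻ x in d ⁻¹' {z}, F x ∂μ := by
    intro F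
    rw [← lintegral_iUnion hm, ← Set.preimage_iUnion, Set.iUnion_of_singleton, Set.preimage_univ,
      Measure.restrict_univ]
    intro z z' hz
    exact Disjoint.preimage d (Set.disjoint_singleton.2 hz)
  rw [hsplit, hsplit]
  refine ENNReal.tsum_le_tsum fun z => ?_
  rcases (d ⁻¹' {z}).eq_empty_or_nonempty with he | ⟨x₀, hx₀⟩
  · simp [he]
  have hc : ∀ F : X → ℝ≥0∞, Measurable F →
      ∫⁻ x in d ⁻¹' {z}, w x * F x ∂μ = w x₀ * ∫⁻ x in d ⁻¹' {z}, F x ∂μ := by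
    intro F hF
    rw [← lintegral_const_mul _ hF]
    refine setLIntegral_congr_fun (hm z) fun x hx => ?_
    simp only [hw x x₀ (hx.trans hx₀.symm)]
  rw [hc G hG, hc H hH]
  exact mul_le_mul_right (hGH z) _

/-- A form of Garsia's lemma: an increasing process whose remaining increments are controlled
in conditional mean by `h` is controlled in `L^p` by `h`. -/
theorem lintegral_rpow_le_of_fiberwise_increment_le {p : ℝ} (hp : 1 < p) {d : ℕ → X → ι}
    (hd : ∀ i, Measurable (d i)) {A : ℕ → X → ℝ≥0∞} (hA : ∀ x, Monotone fun i => A i x)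
    (hA0 : ∀ x, A 0 x = 0) (hAm : ∀ i, Measurable (A i))
    (hAd : ∀ i x y, d i x = d i y → A i x = A i y)
    (hdd : ∀ i x y, d (i + 1) x = d (i + 1) y → d i x = d i y)
    {h : X → ℝ≥0∞} (hh : Measurable h) {C : ℝ≥0∞} {N : ℕ}
    (hinc : ∀ i < N, ∀ z, ∫⁻ x in d (i + 1) ⁻¹' {z}, (A N x - A i x) ∂μ
      ≤ C * ∫⁻ x in d (i + 1) ⁻¹' {z}, h x ∂μ)
    (hfin : ∫⁻ x, A N x ^ p ∂μ ≠ ∞) :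
    ∫⁻ x, A N x ^ p ∂μ ≤ 2 * (2 * (ENNReal.ofReal p * C)) ^ p * ∫⁻ x, h x ^ p ∂μ := by
  have hq : 0 < p - 1 := by linarith
  have hp0 : 0 < p := by linarith
  set S := ∫⁻ x, A N x ^ p ∂μ with hS
  have hae : ∀ᵐ x ∂μ, A N x ≠ ∞ := by
    filter_upwards [ae_lt_top ((hAm N).pow_const p) hfin] with x hx
    intro h'
    rw [h', ENNReal.top_rpow_of_pos hp0] at hx
    exact lt_irrefl _ hx
  have h1 : S ≤ ∫⁻ x, ENNReal.ofReal p * C * h x * A N x ^ (p - 1) ∂μ := by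
    calc S ≤ ∫⁻ x, ENNReal.ofReal p * ∑ i ∈ Finset.range N,
            (A (i + 1) x ^ (p - 1) - A i x ^ (p - 1)) * (A N x - A i x) ∂μ := by
          refine lintegral_mono_ae (hae.mono fun x hx => ?_)
          simp_rw [mul_comm (_ ^ (p - 1) - _)]
          exact rpow_le_sum_mul_sub hp (hA x) (hA0 x) hx
      _ = ENNReal.ofReal p * ∑ i ∈ Finset.range N,
            ∫⁻ x, (A (i + 1) x ^ (p - 1) - A i x ^ (p - 1)) * (A N x - A i x) ∂μ := by
          rw [lintegral_const_mul' _ _ ENNReal.ofReal_ne_top, lintegral_finsetSum]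
          fun_prop
      _ ≤ ENNReal.ofReal p * ∑ i ∈ Finset.range N,
            ∫⁻ x, (A (i + 1) x ^ (p - 1) - A i x ^ (p - 1)) * (C * h x) ∂μ := by
          refine mul_le_mul_right (Finset.sum_le_sum fun i hi => ?_) _
          -- The weight involves `A (i + 1)`, so it is constant only on fibres of `d (i + 1)`. This
          -- is why `hinc` is stated there although the increment starts at `i`.
          refine lintegral_mul_le_of_fiberwise (hd (i + 1))
            (by fun_prop) (by fun_prop) ?_ ?_
          · intro x y hxy
            rw [hAd _ x y hxy, hAd i x y (hdd i x y hxy)]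
          · intro z
            rw [lintegral_const_mul _ hh]
            exact hinc i (Finset.mem_range.1 hi) z
      _ = ∫⁻ x, ENNReal.ofReal p * ∑ i ∈ Finset.range N,
            (A (i + 1) x ^ (p - 1) - A i x ^ (p - 1)) * (C * h x) ∂μ := by
          rw [lintegral_const_mul' _ _ ENNReal.ofReal_ne_top, lintegral_finsetSum]
          fun_prop
      _ = _ := by
          refine lintegral_congr fun x => ?_
          rw [← Finset.sum_mul, sum_range_tsub_of_monotone (B := fun i => A i x ^ (p - 1))
            (fun i j hij => ENNReal.rpow_le_rpow (hA x hij) hq.le)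
            (by simp only [hA0, ENNReal.zero_rpow_of_pos hq])]
          ring
  have h2 : S ≤ 2⁻¹ * S + (2 * (ENNReal.ofReal p * C)) ^ p * ∫⁻ x, h x ^ p ∂μ := by
    refine h1.trans ((lintegral_mono fun x => mul_mul_rpow_le hp _ (h x) (A N x)).trans ?_)
    rw [lintegral_add_left (by fun_prop), lintegral_const_mul _ (by fun_prop),
      lintegral_const_mul _ (by fun_prop)]
  have h3 : S = 2⁻¹ * S + 2⁻¹ * S := by
    rw [← add_mul, ENNReal.inv_two_add_inv_two, one_mul]
  -- Absorbing half of `S` into the left side requires `S` to be finite, which is `hfin`.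
  have h4 : 2⁻¹ * S ≤ (2 * (ENNReal.ofReal p * C)) ^ p * ∫⁻ x, h x ^ p ∂μ := by
    have hfin' : 2⁻¹ * S ≠ ∞ := ENNReal.mul_ne_top (by simp) hfin
    nth_rewrite 1 [h3] at h2
    exact (ENNReal.add_le_add_iff_left hfin').1 h2
  calc S = 2 * (2⁻¹ * S) := by
        rw [← mul_assoc, ENNReal.mul_inv_cancel two_ne_zero ENNReal.ofNat_ne_top, one_mul]
    _ ≤ _ := by rw [mul_assoc]; gcongr

end IncreasingProcess

/-! ### Dyadic cubes and the balls around them -/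

section Dyadic

variable {n : ℕ}

/-- The index of the dyadic cube of side `2⁻ᵏ` that contains `x`. -/
noncomputable def dyadicIndex (k : ℤ) (x : EuclideanSpace ℝ (Fin n)) : Fin n → ℤ :=
  fun i => ⌊(2 : ℝ) ^ k * x i⌋

/-- The lower corner of the dyadic cube of side `2⁻ᵏ` with index `z`. -/
noncomputable def dyadicCorner (k : ℤ) (z : Fin n → ℤ) : EuclideanSpace ℝ (Fin n) :=
  WithLp.toLp 2 fun i => (2 : ℝ) ^ (-k) * z i

/-- An open ball that contains the dyadic cube of side `2⁻ᵏ` with index `z`. -/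
def dyadicBall (k : ℤ) (z : Fin n → ℤ) : Set (EuclideanSpace ℝ (Fin n)) :=
  Metric.ball (dyadicCorner k z) (3 * n * (2 : ℝ) ^ (-k))

theorem measurable_dyadicIndex (k : ℤ) :
    Measurable (dyadicIndex k : EuclideanSpace ℝ (Fin n) → Fin n → ℤ) := by
  unfold dyadicIndex
  exact measurable_pi_iff.2 fun i => Int.measurable_floor.comp (by fun_prop)

/-- Dyadic cubes are nested: `⌊2 ^ k t⌋` is the integer quotient of `⌊2 ^ (k + j) t⌋` by `2 ^ j`. -/
theorem dyadicIndex_eq_of_le {k l : ℤ} (hkl : k ≤ l) {x y : EuclideanSpace ℝ (Fin n)}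
    (h : dyadicIndex l x = dyadicIndex l y) : dyadicIndex k x = dyadicIndex k y := by
  obtain ⟨j, rfl⟩ : ∃ j : ℕ, l = k + j := ⟨(l - k).toNat, by omega⟩
  have key : ∀ t : ℝ, ⌊(2 : ℝ) ^ k * t⌋ = ⌊(2 : ℝ) ^ (k + (j : ℤ)) * t⌋ / ((2 ^ j : ℕ) : ℤ) := by
    intro t
    rw [← Int.floor_div_natCast]
    congr 1
    rw [zpow_add₀ two_ne_zero, zpow_natCast]
    push_cast
    field_simp
  funext i
  have hi := congrFun h i
  simp only [dyadicIndex] at hi ⊢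
  rw [key, key, hi]

theorem norm_le_mul_of_forall_abs_le {v : EuclideanSpace ℝ (Fin n)} {δ : ℝ} (hδ : 0 ≤ δ)
    (h : ∀ i, |v i| ≤ δ) : ‖v‖ ≤ n * δ := by
  rw [EuclideanSpace.norm_eq]
  refine Real.sqrt_le_iff.2 ⟨by positivity, ?_⟩
  calc ∑ i, ‖v i‖ ^ 2 ≤ ∑ _i : Fin n, δ ^ 2 := by
        refine Finset.sum_le_sum fun i _ => ?_
        gcongr
        exact h i
    _ = n * δ ^ 2 := by simp
    _ ≤ n ^ 2 * δ ^ 2 := by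
        gcongr
        exact_mod_cast Nat.le_self_pow two_ne_zero n
    _ = (n * δ) ^ 2 := by ring

theorem dist_dyadicCorner_le (k : ℤ) (x : EuclideanSpace ℝ (Fin n)) :
    dist x (dyadicCorner k (dyadicIndex k x)) ≤ n * (2 : ℝ) ^ (-k) := by
  rw [dist_eq_norm]
  refine norm_le_mul_of_forall_abs_le (by positivity) fun i => ?_
  have h2 : (0 : ℝ) < 2 ^ (-k) := by positivity
  have e : x i = (2 : ℝ) ^ (-k) * ((2 : ℝ) ^ k * x i) := by
    rw [← mul_assoc, ← zpow_add₀ two_ne_zero]; simp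
  have h3 := Int.floor_le ((2 : ℝ) ^ k * x i)
  have h4 := Int.lt_floor_add_one ((2 : ℝ) ^ k * x i)
  simp only [dyadicCorner, dyadicIndex, PiLp.sub_apply]
  rw [e, ← mul_sub, abs_mul, abs_of_pos h2, ← e]
  refine mul_le_of_le_one_right h2.le ?_
  rw [abs_le]
  constructor <;> linarith

theorem dyadicBall_radius_pos (hn : 1 ≤ n) (k : ℤ) : 0 < 3 * n * (2 : ℝ) ^ (-k) := by
  have : (0 : ℝ) < n := by exact_mod_cast hn
  positivity

theorem mem_dyadicBall (hn : 1 ≤ n) (k : ℤ) (x : EuclideanSpace ℝ (Fin n)) :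
    x ∈ dyadicBall k (dyadicIndex k x) := by
  refine (dist_dyadicCorner_le k x).trans_lt ?_
  have := dyadicBall_radius_pos hn k
  linarith

/-- This fixes the factor `3` in the radius: with `δ = 2 ^ (-k)` and `l > k`, the distances add up
to at most `3nδ/2 + nδ/2 + nδ = 3nδ`. -/
theorem dyadicBall_subset {k l : ℤ} (hkl : k ≤ l) (x : EuclideanSpace ℝ (Fin n)) :
    dyadicBall l (dyadicIndex l x) ⊆ dyadicBall k (dyadicIndex k x) := by
  rcases hkl.eq_or_lt with rfl | hkl
  · exact subset_rfl
  intro y hy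
  have h1 : dist y (dyadicCorner l (dyadicIndex l x)) < 3 * n * (2 : ℝ) ^ (-l) := hy
  have h2 := dist_dyadicCorner_le l x
  have h3 := dist_dyadicCorner_le k x
  have h4 : (2 : ℝ) ^ (-l) ≤ (2 : ℝ) ^ (-k) / 2 := by
    rw [div_eq_mul_inv, ← zpow_sub_one₀ (two_ne_zero' ℝ)]
    exact zpow_le_zpow_right₀ one_le_two (by omega)
  have h5 : (n : ℝ) * (2 : ℝ) ^ (-l) ≤ n * ((2 : ℝ) ^ (-k) / 2) := by gcongr
  rw [dist_comm] at h2
  change dist y (dyadicCorner k (dyadicIndex k x)) < _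
  linarith [dist_triangle y (dyadicCorner l (dyadicIndex l x)) (dyadicCorner k (dyadicIndex k x)),
    dist_triangle (dyadicCorner l (dyadicIndex l x)) x (dyadicCorner k (dyadicIndex k x))]

theorem volume_dyadicBall_eq (hn : 1 ≤ n) (k l : ℤ) (z w : Fin n → ℤ) :
    volume (dyadicBall k z) = ENNReal.ofReal (((2 : ℝ) ^ (l - k)) ^ n) * volume (dyadicBall l w) := by
  unfold dyadicBall
  rw [← volume_ball_mul (dyadicCorner k z) (dyadicCorner l w) (dyadicBall_radius_pos hn l)
    (by positivity)]
  congr 2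
  rw [mul_left_comm, ← zpow_add₀ two_ne_zero]
  congr 2
  ring

/-- A cube of side `δ = 2 ^ (-(k + 1))` contains a ball of radius `δ / 2`, and `3n · 2δ = 12n · δ /
2`. -/
theorem volume_dyadicBall_le (hn : 1 ≤ n) (k : ℤ) (z w : Fin n → ℤ) :
    volume (dyadicBall k z)
      ≤ ENNReal.ofReal ((12 * n) ^ n) * volume (dyadicIndex (k + 1) ⁻¹' {w}) := by
  have hn' : (0 : ℝ) < n := by exact_mod_cast hn
  set δ : ℝ := (2 : ℝ) ^ (-(k + 1)) with hδ
  have hδ0 : 0 < δ := by positivity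
  have hδ' : δ * (2 : ℝ) ^ (k + 1) = 1 := by rw [hδ, ← zpow_add₀ two_ne_zero]; simp
  have hrad : 3 * n * (2 : ℝ) ^ (-k) = 12 * n * (δ / 2) := by
    have : (2 : ℝ) ^ (-k) = 2 * δ := by
      rw [hδ, show -k = -(k + 1) + 1 by ring, zpow_add_one₀ two_ne_zero]; ring
    rw [this]; ring
  let c : EuclideanSpace ℝ (Fin n) := WithLp.toLp 2 fun i => δ * (w i + 1 / 2)
  have hsub : Metric.ball c (δ / 2) ⊆ dyadicIndex (k + 1) ⁻¹' {w} := by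
    intro y hy
    funext i
    have h1 : |y i - δ * (w i + 1 / 2)| < δ / 2 := by
      refine lt_of_le_of_lt ?_ (mem_ball_iff_norm.1 hy)
      have := PiLp.norm_apply_le (y - c) i
      simpa [c] using this
    rw [abs_lt] at h1
    simp only [dyadicIndex]
    rw [Int.floor_eq_iff]
    have e : (2 : ℝ) ^ (k + 1) * δ = 1 := by rw [mul_comm]; exact hδ'
    have hpos : (0 : ℝ) < (2 : ℝ) ^ (k + 1) := by positivity
    constructor
    · calc (w i : ℝ) = (2 : ℝ) ^ (k + 1) * (δ * w i) := by rw [← mul_assoc, e, one_mul]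
        _ ≤ _ := by gcongr; linarith
    · calc (2 : ℝ) ^ (k + 1) * y i < (2 : ℝ) ^ (k + 1) * (δ * (w i + 1)) := by
            gcongr; linarith
        _ = w i + 1 := by rw [← mul_assoc, e, one_mul]
  unfold dyadicBall
  rw [hrad, volume_ball_mul _ c (half_pos hδ0) (by positivity)]
  gcongr

end Dyadic

/-! ### Best approximation on a ball -/

section LocalApproximation

variable {n m : ℕ} {f : EuclideanSpace ℝ (Fin n) → ℂ}

theorem IsL2Loc.memLp_ball (hf : IsL2Loc f) (c : EuclideanSpace ℝ (Fin n)) (r : ℝ) :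
    MemLp f 2 (volume.restrict (Metric.ball c r)) :=
  (hf _ (isCompact_closedBall c r)).mono_measure
    (Measure.restrict_mono Metric.ball_subset_closedBall le_rfl)

theorem IsL2Loc.aestronglyMeasurable (hf : IsL2Loc f) : AEStronglyMeasurable f volume := by
  have : (⋃ k : ℕ, Metric.ball (0 : EuclideanSpace ℝ (Fin n)) k) = Set.univ :=
    Metric.iUnion_ball_nat 0
  rw [← Measure.restrict_univ (μ := volume), ← this, aestronglyMeasurable_iUnion_iff]
  exact fun k => (hf.memLp_ball 0 k).1

theorem IsL2Loc.locallyIntegrable (hf : IsL2Loc f) : LocallyIntegrable f volume := by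
  refine (locallyIntegrable_iff).2 fun K hK => ?_
  have : IsFiniteMeasure (volume.restrict K) := ⟨by simpa using hK.measure_lt_top⟩
  exact (hf K hK).integrable (by norm_num)

theorem setLIntegral_le_rpow_mul_rpow {X : Type*} [MeasurableSpace X] {μ : Measure X} {s : Set X}
    {g : X → ℝ≥0∞} (hg : AEMeasurable g (μ.restrict s)) :
    ∫⁻ x in s, g x ∂μ ≤ μ s ^ (1 / 2 : ℝ) * (∫⁻ x in s, g x ^ 2 ∂μ) ^ (1 / 2 : ℝ) := by
  have := ENNReal.lintegral_mul_le_Lp_mul_Lq (μ.restrict s) Real.HolderConjugate.two_two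
    (aemeasurable_const (b := 1)) hg
  simpa using this

theorem setLAverage_le_rpow {X : Type*} [MeasurableSpace X] {μ : Measure X} {s : Set X}
    {g : X → ℝ≥0∞} (hg : AEMeasurable g (μ.restrict s)) (h0 : μ s ≠ 0) (ht : μ s ≠ ∞) :
    ⨍⁻ x in s, g x ∂μ ≤ (⨍⁻ x in s, g x ^ 2 ∂μ) ^ (1 / 2 : ℝ) := by
  rw [setLAverage_eq, setLAverage_eq, ENNReal.div_le_iff h0 ht,
    ENNReal.div_rpow_of_nonneg _ _ (by norm_num)]
  refine (setLIntegral_le_rpow_mul_rpow hg).trans (le_of_eq ?_)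
  have h1 : μ s = μ s ^ (1 / 2 : ℝ) * μ s ^ (1 / 2 : ℝ) := by
    rw [← ENNReal.rpow_add _ _ h0 ht]; norm_num
  have h2 : μ s ^ (1 / 2 : ℝ) ≠ 0 := (ENNReal.rpow_pos (pos_iff_ne_zero.2 h0) ht).ne'
  have h3 : μ s ^ (1 / 2 : ℝ) ≠ ∞ := ENNReal.rpow_ne_top_of_nonneg (by norm_num) ht
  nth_rewrite 3 [h1]
  rw [← mul_assoc, ENNReal.div_mul_cancel h2 h3, mul_comm]

theorem setLAverage_le_mul_of_subset {X : Type*} [MeasurableSpace X] {μ : Measure X} {s t : Set X}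
    (hst : s ⊆ t) (hs0 : μ s ≠ 0) (ht : μ t ≠ ∞) {K : ℝ≥0∞} (hK : μ t ≤ K * μ s) (g : X → ℝ≥0∞) :
    ⨍⁻ x in s, g x ∂μ ≤ K * ⨍⁻ x in t, g x ∂μ := by
  have ht0 : μ t ≠ 0 := fun h => hs0 (measure_mono_null hst h)
  rw [setLAverage_eq, ENNReal.div_le_iff hs0 (measure_ne_top_of_subset hst ht)]
  calc ∫⁻ x in s, g x ∂μ ≤ ∫⁻ x in t, g x ∂μ := lintegral_mono_set hst
    _ = μ t * ⨍⁻ x in t, g x ∂μ := (measure_mul_setLAverage g ht).symm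
    _ ≤ K * μ s * ⨍⁻ x in t, g x ∂μ := by gcongr
    _ = _ := by ring

/-- `P` is a best approximation of `f` in `L²(B(c, r))` by polynomials of degree less than `m`. -/
def IsBestApprox (m : ℕ) (f : EuclideanSpace ℝ (Fin n) → ℂ) (c : EuclideanSpace ℝ (Fin n)) (r : ℝ)
    (P : MvPolynomial (Fin n) ℂ) : Prop :=
  P.totalDegree < m ∧
    (⨍⁻ y in Metric.ball c r, ‖f y - polyFun P y‖ₑ ^ 2 ∂volume) ^ (1 / 2 : ℝ)
      ≤ polyOscillation m f c r

theorem polyOscillation_le_polySharp {c x : EuclideanSpace ℝ (Fin n)} {r : ℝ} (hr : 0 < r)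
    (hx : x ∈ Metric.ball c r) : polyOscillation m f c r ≤ polySharp m f x :=
  le_iSup₂_of_le c r (le_iSup₂_of_le hr hx le_rfl)

theorem aemeasurable_enorm_sub_polyFun (hf : AEStronglyMeasurable f volume)
    (P : MvPolynomial (Fin n) ℂ) : AEMeasurable (fun y => ‖f y - polyFun P y‖ₑ) volume :=
  (hf.sub (continuous_polyFun P).aestronglyMeasurable).enorm

theorem IsBestApprox.laverage_le_polySharp {c x : EuclideanSpace ℝ (Fin n)} {r : ℝ}
    {P : MvPolynomial (Fin n) ℂ} (hP : IsBestApprox m f c r P) (hf : AEStronglyMeasurable f volume)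
    (hr : 0 < r) (hx : x ∈ Metric.ball c r) :
    ⨍⁻ y in Metric.ball c r, ‖f y - polyFun P y‖ₑ ∂volume ≤ polySharp m f x :=
  (setLAverage_le_rpow (aemeasurable_enorm_sub_polyFun hf P).restrict
    (volume_ball_ne_zero c hr) (volume_ball_ne_top c r)).trans
    (hP.2.trans (polyOscillation_le_polySharp hr hx))

/-- The constant of `exists_enorm_polyFun_le_laverage`. -/
noncomputable def polyConst (n m : ℕ) : ℝ≥0∞ := (exists_enorm_polyFun_le_laverage n m).choose

theorem polyConst_ne_top (n m : ℕ) : polyConst n m ≠ ∞ :=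
  (exists_enorm_polyFun_le_laverage n m).choose_spec.1

theorem enorm_polyFun_le_laverage {P : MvPolynomial (Fin n) ℂ} (hP : P.totalDegree < m)
    {c y : EuclideanSpace ℝ (Fin n)} {r : ℝ} (hr : 0 < r) (hy : y ∈ Metric.ball c r) :
    ‖polyFun P y‖ₑ ≤ polyConst n m * ⨍⁻ z in Metric.ball c r, ‖polyFun P z‖ₑ ∂volume :=
  (exists_enorm_polyFun_le_laverage n m).choose_spec.2 P hP c r hr y hy

/-- `P - Q` again has degree less than `m`, so its values are controlled by its mean, which the
triangle inequality through `f` bounds. -/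
theorem enorm_polyFun_sub_le (hf : AEStronglyMeasurable f volume) {P Q : MvPolynomial (Fin n) ℂ}
    (hP : P.totalDegree < m) (hQ : Q.totalDegree < m)
    {c y : EuclideanSpace ℝ (Fin n)} {r : ℝ} (hr : 0 < r) (hy : y ∈ Metric.ball c r) :
    ‖polyFun P y - polyFun Q y‖ₑ ≤ polyConst n m *
      (⨍⁻ z in Metric.ball c r, ‖f z - polyFun P z‖ₑ ∂volume
        + ⨍⁻ z in Metric.ball c r, ‖f z - polyFun Q z‖ₑ ∂volume) := by
  rw [← polyFun_sub]
  refine (enorm_polyFun_le_laverage (totalDegree_sub_lt hP hQ) hr hy).trans ?_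
  gcongr
  simp only [setLAverage_eq]
  rw [← ENNReal.add_div, ← lintegral_add_left' (aemeasurable_enorm_sub_polyFun hf P).restrict]
  gcongr with z
  rw [polyFun_sub, enorm_sub_rev (f z) (polyFun P z)]
  calc ‖polyFun P z - polyFun Q z‖ₑ
      = ‖(polyFun P z - f z) + (f z - polyFun Q z)‖ₑ := by rw [sub_add_sub_cancel]
    _ ≤ _ := enorm_add_le _ _

theorem measurable_of_fiberwise_const {X ι Y : Type*} [MeasurableSpace X] [MeasurableSpace Y]
    [Countable ι] [MeasurableSpace ι] [MeasurableSingletonClass ι] {d : X → ι} (hd : Measurable d)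
    {F : X → Y} (hF : ∀ x y, d x = d y → F x = F y) : Measurable F := by
  intro s _
  have : F ⁻¹' s = d ⁻¹' (d '' (F ⁻¹' s)) := by
    refine Set.Subset.antisymm (Set.subset_preimage_image d _) ?_
    rintro x ⟨y, hy, hxy⟩
    rw [Set.mem_preimage, hF x y hxy.symm]
    exact hy
  rw [this]
  exact hd (Set.to_countable _).measurableSet

end LocalApproximation

/-! ### Dyadic approximations and their uniform `L^p` bound -/

section DyadicApproximation

variable {n m : ℕ} {f : EuclideanSpace ℝ (Fin n) → ℂ}
  {P : ℤ → (Fin n → ℤ) → MvPolynomial (Fin n) ℂ}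

/-- A family of best approximations on all dyadic balls. -/
def IsDyadicApprox (m : ℕ) (f : EuclideanSpace ℝ (Fin n) → ℂ)
    (P : ℤ → (Fin n → ℤ) → MvPolynomial (Fin n) ℂ) : Prop :=
  ∀ k z, IsBestApprox m f (dyadicCorner k z) (3 * n * (2 : ℝ) ^ (-k)) (P k z)

/-- The supremum over the dyadic cube of generation `l` around `x` of the difference of the
approximating polynomials of generations `l` and `k`. -/
noncomputable def cubeDiff (P : ℤ → (Fin n → ℤ) → MvPolynomial (Fin n) ℂ) (l k : ℤ)
    (x : EuclideanSpace ℝ (Fin n)) : ℝ≥0∞ :=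
  ⨆ (y : EuclideanSpace ℝ (Fin n)) (_ : dyadicIndex l y = dyadicIndex l x),
    ‖polyFun (P l (dyadicIndex l x)) y - polyFun (P k (dyadicIndex k x)) y‖ₑ

/-- The running maximum of `cubeDiff` over `i + 1` generations. -/
noncomputable def maxCubeDiff (P : ℤ → (Fin n → ℤ) → MvPolynomial (Fin n) ℂ) (k : ℤ) (i : ℕ)
    (x : EuclideanSpace ℝ (Fin n)) : ℝ≥0∞ :=
  ⨆ (j : ℕ) (_ : j ≤ i), cubeDiff P (k + j) k x

theorem cubeDiff_congr {l k : ℤ} (hkl : k ≤ l) {x y : EuclideanSpace ℝ (Fin n)}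
    (h : dyadicIndex l x = dyadicIndex l y) : cubeDiff P l k x = cubeDiff P l k y := by
  simp only [cubeDiff, h, dyadicIndex_eq_of_le hkl h]

theorem maxCubeDiff_congr {k : ℤ} {i : ℕ} {x y : EuclideanSpace ℝ (Fin n)}
    (h : dyadicIndex (k + i) x = dyadicIndex (k + i) y) :
    maxCubeDiff P k i x = maxCubeDiff P k i y := by
  unfold maxCubeDiff
  refine iSup_congr fun j => iSup_congr fun hj => ?_
  exact cubeDiff_congr (by omega) (dyadicIndex_eq_of_le (by omega) h)

theorem measurable_maxCubeDiff (k : ℤ) (i : ℕ) : Measurable (maxCubeDiff P k i) :=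
  measurable_of_fiberwise_const (measurable_dyadicIndex (k + i)) fun _ _ => maxCubeDiff_congr

theorem monotone_maxCubeDiff (k : ℤ) (x : EuclideanSpace ℝ (Fin n)) :
    Monotone fun i => maxCubeDiff P k i x := fun _ _ hij =>
  iSup_mono fun _ => iSup_mono' fun h => ⟨h.trans hij, le_rfl⟩

theorem maxCubeDiff_zero (k : ℤ) (x : EuclideanSpace ℝ (Fin n)) : maxCubeDiff P k 0 x = 0 := by
  simp [maxCubeDiff, cubeDiff]

theorem cubeDiff_le_maxCubeDiff (k : ℤ) {i j : ℕ} (hj : j ≤ i) (x : EuclideanSpace ℝ (Fin n)) :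
    cubeDiff P (k + j) k x ≤ maxCubeDiff P k i x :=
  le_iSup₂_of_le j hj le_rfl

theorem cubeDiff_triangle {l k k' : ℤ} (hkl : k ≤ l) (x : EuclideanSpace ℝ (Fin n)) :
    cubeDiff P l k' x ≤ cubeDiff P l k x + cubeDiff P k k' x := by
  refine iSup₂_le fun y hy => ?_
  calc ‖polyFun (P l (dyadicIndex l x)) y - polyFun (P k' (dyadicIndex k' x)) y‖ₑ
      ≤ ‖polyFun (P l (dyadicIndex l x)) y - polyFun (P k (dyadicIndex k x)) y‖ₑ
        + ‖polyFun (P k (dyadicIndex k x)) y - polyFun (P k' (dyadicIndex k' x)) y‖ₑ := by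
        rw [← sub_add_sub_cancel _ (polyFun (P k (dyadicIndex k x)) y)]
        exact enorm_add_le _ _
    _ ≤ _ := add_le_add (le_iSup₂_of_le y hy le_rfl)
        (le_iSup₂_of_le y (dyadicIndex_eq_of_le hkl hy) le_rfl)

/-- The mean of `f - P k` over the generation `l` ball is left as it stands. It is bounded later
either crudely by a volume ratio or sharply by a maximal function. -/
theorem cubeDiff_le (hn : 1 ≤ n) (hf : AEStronglyMeasurable f volume) (hP : IsDyadicApprox m f P)
    (l k : ℤ) (x : EuclideanSpace ℝ (Fin n)) :
    cubeDiff P l k x ≤ polyConst n m * (polySharp m f x +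
      ⨍⁻ z in dyadicBall l (dyadicIndex l x),
        ‖f z - polyFun (P k (dyadicIndex k x)) z‖ₑ ∂volume) := by
  refine iSup₂_le fun y hy => ?_
  have hr := dyadicBall_radius_pos hn l
  have hyB : y ∈ dyadicBall l (dyadicIndex l x) := hy ▸ mem_dyadicBall hn l y
  refine (enorm_polyFun_sub_le hf (hP l _).1 (hP k _).1 hr hyB).trans ?_
  gcongr
  · exact (hP l _).laverage_le_polySharp hf hr (mem_dyadicBall hn l x)
  · exact le_rfl

/-- A qualitative bound whose constant grows like the volume ratio `2 ^ (i n)`. It only supplies the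
finiteness that Garsia's lemma needs. -/
theorem maxCubeDiff_le_const_mul (hn : 1 ≤ n) (hf : AEStronglyMeasurable f volume)
    (hP : IsDyadicApprox m f P) (k : ℤ) (i : ℕ) :
    ∃ C : ℝ≥0∞, C ≠ ∞ ∧ ∀ x, maxCubeDiff P k i x ≤ C * polySharp m f x := by
  refine ⟨polyConst n m * (1 + ENNReal.ofReal (((2 : ℝ) ^ (i : ℤ)) ^ n)),
    ENNReal.mul_ne_top (polyConst_ne_top n m) (by finiteness), fun x => ?_⟩
  refine iSup₂_le fun j hj => (cubeDiff_le hn hf hP _ _ x).trans ?_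
  rw [mul_assoc, add_mul, one_mul]
  gcongr
  have hk := (hP k _).laverage_le_polySharp hf (dyadicBall_radius_pos hn k) (mem_dyadicBall hn k x)
  refine le_trans ?_ (mul_le_mul_right hk _)
  have hvol := volume_dyadicBall_eq hn k (k + j) (dyadicIndex k x) (dyadicIndex (k + j) x)
  rw [add_sub_cancel_left] at hvol
  refine (setLAverage_le_mul_of_subset (dyadicBall_subset (by omega) x)
    (volume_ball_ne_zero _ (dyadicBall_radius_pos hn (k + j))) (volume_ball_ne_top _ _)
    hvol.le _).trans (mul_le_mul_left ?_ _)
  gcongr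
  norm_num

/-- Only generations `j > i` add to the maximum. Passing through generation `k + i` leaves a mean of
`f - P (k + i)` over a smaller ball containing `x`, and nesting allows the function to be cut off to
the larger ball. -/
theorem maxCubeDiff_sub_le (hn : 1 ≤ n) (hf : AEStronglyMeasurable f volume)
    (hP : IsDyadicApprox m f P) (k : ℤ) (i N : ℕ) (x : EuclideanSpace ℝ (Fin n)) :
    maxCubeDiff P k N x - maxCubeDiff P k i x ≤ polyConst n m * (polySharp m f x +
      maximalFn ((dyadicBall (k + i) (dyadicIndex (k + i) x)).indicator
        fun z => ‖f z - polyFun (P (k + i) (dyadicIndex (k + i) x)) z‖ₑ) x) := by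
  rw [tsub_le_iff_left]
  refine iSup₂_le fun j _ => ?_
  rcases le_or_gt j i with hji | hij
  · exact le_add_right (cubeDiff_le_maxCubeDiff k hji x)
  refine (cubeDiff_triangle (l := k + j) (k := k + i) (by omega) x).trans ?_
  rw [add_comm]
  refine add_le_add (cubeDiff_le_maxCubeDiff k le_rfl x) ((cubeDiff_le hn hf hP _ _ x).trans ?_)
  gcongr
  have hr := dyadicBall_radius_pos hn (k + j)
  refine le_of_eq_of_le ?_
    (laverage_ball_le_maximalFn ((dyadicBall (k + i) (dyadicIndex (k + i) x)).indicator
        fun z => ‖f z - polyFun (P (k + i) (dyadicIndex (k + i) x)) z‖ₑ) hr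
      (mem_dyadicBall hn (k + j) x))
  refine setLAverage_congr_fun measurableSet_ball fun z hz => ?_
  have hz' : z ∈ dyadicBall (k + i) (dyadicIndex (k + i) x) :=
    dyadicBall_subset (by omega) x hz
  simp only [Set.indicator_of_mem hz']

/-- The conditional mean of the increments of the running maximum is controlled by the sharp
function. -/
theorem exists_setLIntegral_maxCubeDiff_sub_le (m : ℕ) (hn : 1 ≤ n) : ∃ C : ℝ≥0∞, C ≠ ∞ ∧
    ∀ (f : EuclideanSpace ℝ (Fin n) → ℂ) (P : ℤ → (Fin n → ℤ) → MvPolynomial (Fin n) ℂ),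
      AEStronglyMeasurable f volume → IsDyadicApprox m f P → ∀ (k : ℤ) (i N : ℕ) (w : Fin n → ℤ),
        ∫⁻ x in dyadicIndex (k + i + 1) ⁻¹' {w}, (maxCubeDiff P k N x - maxCubeDiff P k i x)
          ≤ C * ∫⁻ x in dyadicIndex (k + i + 1) ⁻¹' {w}, polySharp m f x := by
  obtain ⟨C₂, hC₂, hmax⟩ := exists_lintegral_maximalFn_rpow_le hn (q := 2) (by norm_num)
  set K : ℝ≥0∞ := C₂ * ENNReal.ofReal ((12 * n) ^ n) with hK
  have hKt : K ≠ ∞ := ENNReal.mul_ne_top hC₂ ENNReal.ofReal_ne_top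
  refine ⟨polyConst n m * (1 + K ^ (1 / 2 : ℝ)), ENNReal.mul_ne_top (polyConst_ne_top n m)
    (ENNReal.add_ne_top.2 ⟨ENNReal.one_ne_top,
      ENNReal.rpow_ne_top_of_nonneg (by norm_num) hKt⟩), ?_⟩
  intro f P hf hP k i N w
  set Q := dyadicIndex (k + i + 1) ⁻¹' {w} with hQ
  have hQm : MeasurableSet Q := measurable_dyadicIndex _ (measurableSet_singleton w)
  rcases Q.eq_empty_or_nonempty with he | ⟨x₀, hx₀⟩
  · simp [he]
  set z := dyadicIndex (k + i) x₀ with hz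
  have hzx : ∀ x ∈ Q, dyadicIndex (k + i) x = z := fun x hx =>
    dyadicIndex_eq_of_le (l := k + i + 1) (by omega) (hx.trans hx₀.symm)
  set B := dyadicBall (k + i) z with hB
  have hBm : MeasurableSet B := measurableSet_ball
  have hr := dyadicBall_radius_pos hn (k + i)
  have hB0 : volume B ≠ 0 := volume_ball_ne_zero _ hr
  have hBt : volume B ≠ ∞ := volume_ball_ne_top _ _
  set F : EuclideanSpace ℝ (Fin n) → ℝ≥0∞ :=
    B.indicator fun y => ‖f y - polyFun (P (k + i) z) y‖ₑ with hF
  have hFm : AEMeasurable F := (aemeasurable_enorm_sub_polyFun hf _).indicator hBm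
  set o := (⨍⁻ y in B, ‖f y - polyFun (P (k + i) z) y‖ₑ ^ 2 ∂volume) ^ (1 / 2 : ℝ) with ho
  have hosc : ∀ x ∈ Q, o ≤ polySharp m f x := fun x hx =>
    (hP (k + i) z).2.trans (polyOscillation_le_polySharp hr (by
      have := mem_dyadicBall hn (k + i) x
      rwa [hzx x hx] at this))
  have hF2 : ∫⁻ x, F x ^ (2 : ℝ) = volume B * o ^ 2 := by
    have h1 : o ^ 2 = ⨍⁻ y in B, ‖f y - polyFun (P (k + i) z) y‖ₑ ^ 2 ∂volume := by
      rw [ho, ← ENNReal.rpow_natCast, ← ENNReal.rpow_mul]; norm_num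
    rw [h1, measure_mul_setLAverage _ hBt, ← lintegral_indicator hBm]
    refine lintegral_congr fun y => ?_
    by_cases hy : y ∈ B <;> simp [hF, hy]
  -- Cauchy–Schwarz on `Q`, the `L²` maximal inequality, and the comparability of `B` with `Q` give
  -- at most `K ^ (1 / 2) * o * volume Q`; moreover `o ≤ f^#` throughout `Q`.
  have hMF : ∫⁻ x in Q, maximalFn F x ≤ K ^ (1 / 2 : ℝ) * ∫⁻ x in Q, polySharp m f x := by
    calc ∫⁻ x in Q, maximalFn F x
        ≤ volume Q ^ (1 / 2 : ℝ) * (∫⁻ x in Q, maximalFn F x ^ 2) ^ (1 / 2 : ℝ) :=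
          setLIntegral_le_rpow_mul_rpow (measurable_maximalFn F).aemeasurable
      _ ≤ volume Q ^ (1 / 2 : ℝ) * (K * volume Q * o ^ 2) ^ (1 / 2 : ℝ) := by
          gcongr
          calc ∫⁻ x in Q, maximalFn F x ^ 2 ≤ ∫⁻ x, maximalFn F x ^ (2 : ℝ) := by
                simp_rw [ENNReal.rpow_two]
                exact setLIntegral_le_lintegral _ _
            _ ≤ C₂ * (volume B * o ^ 2) := hF2 ▸ hmax F hFm
            _ ≤ C₂ * (ENNReal.ofReal ((12 * n) ^ n) * volume Q * o ^ 2) := by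
                gcongr
                exact volume_dyadicBall_le hn (k + i) z w
            _ = _ := by rw [hK]; ring
      _ = K ^ (1 / 2 : ℝ) * (o * volume Q) := by
          rw [ENNReal.mul_rpow_of_nonneg _ _ (by norm_num),
            ENNReal.mul_rpow_of_nonneg _ _ (by norm_num), ← ENNReal.rpow_natCast o,
            ← ENNReal.rpow_mul o]
          have h1 : volume Q = volume Q ^ (1 / 2 : ℝ) * volume Q ^ (1 / 2 : ℝ) := by
            rw [← ENNReal.rpow_add_of_nonneg _ _ (by norm_num) (by norm_num)]; norm_num
          nth_rewrite 3 [h1]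
          norm_num
          ring
      _ ≤ _ := by
          gcongr
          rw [← setLIntegral_const]
          exact setLIntegral_mono' hQm hosc
  calc ∫⁻ x in Q, (maxCubeDiff P k N x - maxCubeDiff P k i x)
      ≤ ∫⁻ x in Q, polyConst n m * (polySharp m f x + maximalFn F x) := by
        refine setLIntegral_mono' hQm fun x hx => ?_
        have := maxCubeDiff_sub_le hn hf hP k i N x
        rwa [hzx x hx] at this
    _ = polyConst n m * ((∫⁻ x in Q, polySharp m f x) + ∫⁻ x in Q, maximalFn F x) := by
        rw [lintegral_const_mul' _ _ (polyConst_ne_top n m),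
          lintegral_add_left (measurable_polySharp m f)]
    _ ≤ _ := by
        rw [mul_assoc, add_mul, one_mul]
        gcongr

theorem exists_lintegral_maxCubeDiff_rpow_le (m : ℕ) (hn : 1 ≤ n) {p : ℝ} (hp : 1 < p) :
    ∃ C : ℝ≥0∞, C ≠ ∞ ∧
    ∀ (f : EuclideanSpace ℝ (Fin n) → ℂ) (P : ℤ → (Fin n → ℤ) → MvPolynomial (Fin n) ℂ),
      AEStronglyMeasurable f volume → IsDyadicApprox m f P → ∫⁻ x, polySharp m f x ^ p ≠ ∞ →
      ∀ (k : ℤ) (N : ℕ), ∫⁻ x, maxCubeDiff P k N x ^ p ≤ C * ∫⁻ x, polySharp m f x ^ p := by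
  have hp0 : 0 < p := by linarith
  obtain ⟨C, hC, hinc⟩ := exists_setLIntegral_maxCubeDiff_sub_le m hn
  refine ⟨2 * (2 * (ENNReal.ofReal p * C)) ^ p, ENNReal.mul_ne_top (by simp)
    (ENNReal.rpow_ne_top_of_nonneg hp0.le (by finiteness)), ?_⟩
  intro f P hf hP hfin k N
  have hmeas := measurable_polySharp m f
  refine lintegral_rpow_le_of_fiberwise_increment_le hp (d := fun i => dyadicIndex (k + i))
    (fun i => measurable_dyadicIndex _) (monotone_maxCubeDiff k) (maxCubeDiff_zero k)
    (measurable_maxCubeDiff k) (fun i x y => maxCubeDiff_congr)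
    (fun i x y => dyadicIndex_eq_of_le (by omega)) hmeas ?_ ?_
  · intro i _ z
    have := hinc f P hf hP k i N z
    rwa [add_assoc] at this
  · obtain ⟨D, hD, hle⟩ := maxCubeDiff_le_const_mul hn hf hP k N
    refine ne_top_of_le_ne_top (ENNReal.mul_ne_top
      (ENNReal.rpow_ne_top_of_nonneg hp0.le hD) hfin) ?_
    calc ∫⁻ x, maxCubeDiff P k N x ^ p ≤ ∫⁻ x, D ^ p * polySharp m f x ^ p := by
          refine lintegral_mono fun x => ?_
          rw [← ENNReal.mul_rpow_of_nonneg _ _ hp0.le]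
          exact ENNReal.rpow_le_rpow (hle x) hp0.le
      _ = _ := lintegral_const_mul _ (hmeas.pow_const p)

/-- Lebesgue differentiation along balls that contain `x` without being centred there; open and
closed balls have equal volume. -/
theorem tendsto_laverage_dyadicBall (hn : 1 ≤ n) (hf : LocallyIntegrable f volume) (k : ℤ) :
    ∀ᵐ x, Filter.Tendsto (fun N : ℕ => ⨍⁻ y in dyadicBall (k + N) (dyadicIndex (k + N) x),
      ‖f y - f x‖ₑ ∂volume) Filter.atTop (nhds 0) := by
  filter_upwards [IsUnifLocDoublingMeasure.ae_tendsto_average_norm_sub volume hf 1] with x hx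
  have hr : ∀ N : ℕ, 0 < 3 * n * (2 : ℝ) ^ (-(k + N : ℤ)) := fun N => dyadicBall_radius_pos hn _
  have hδ : Filter.Tendsto (fun N : ℕ => 3 * n * (2 : ℝ) ^ (-(k + N : ℤ))) Filter.atTop
      (nhdsWithin 0 (Set.Ioi 0)) := by
    refine tendsto_nhdsWithin_iff.2 ⟨?_, Filter.Eventually.of_forall hr⟩
    have h1 : ∀ N : ℕ, 3 * n * (2 : ℝ) ^ (-(k + N : ℤ))
        = 3 * n * (2 : ℝ) ^ (-k) * (1 / 2) ^ N := fun N => by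
      rw [neg_add, zpow_add₀ two_ne_zero, zpow_neg 2 (N : ℤ), zpow_natCast, one_div, inv_pow]
      ring
    simp_rw [h1]
    have := (tendsto_pow_atTop_nhds_zero_of_lt_one (r := (1 / 2 : ℝ)) (by norm_num)
      (by norm_num)).const_mul (3 * n * (2 : ℝ) ^ (-k))
    rwa [mul_zero] at this
  have h := hx (fun N : ℕ => dyadicCorner (k + N) (dyadicIndex (k + N) x)) _ hδ
    (Filter.Eventually.of_forall fun N => by
      rw [one_mul]; exact Metric.ball_subset_closedBall (mem_dyadicBall hn _ x))
  have h' := ENNReal.tendsto_ofReal h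
  rw [ENNReal.ofReal_zero] at h'
  refine tendsto_of_tendsto_of_tendsto_of_le_of_le tendsto_const_nhds h' (fun _ => zero_le) ?_
  intro N
  have hint : IntegrableOn (fun y => ‖f y - f x‖)
      (Metric.closedBall (dyadicCorner (k + N) (dyadicIndex (k + N) x))
        (3 * n * (2 : ℝ) ^ (-(k + N : ℤ)))) :=
    ((hf.sub (locallyIntegrable_const (f x))).integrableOn_isCompact
      (isCompact_closedBall _ _)).norm
  simp only
  rw [ofReal_average hint (ae_of_all _ fun _ => norm_nonneg _), setLAverage_eq,
    Measure.restrict_apply_univ, volume_closedBall_eq _ (hr N).le,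
    ← volume_ball_eq (dyadicCorner (k + N) (dyadicIndex (k + N) x)) (hr N)]
  simp_rw [ofReal_norm]
  exact ENNReal.div_le_div_right (lintegral_mono_set Metric.ball_subset_closedBall) _

/-- At a Lebesgue point the constant polynomial `f x`, admissible since `m ≥ 1`, approximates `f` on
small balls. Comparing it with the approximation of generation `k + N` costs only `f^# x` as `N →
∞`. -/
theorem ae_enorm_sub_le (hn : 1 ≤ n) (hm : 1 ≤ m) (hf : IsL2Loc f) (hP : IsDyadicApprox m f P)
    (k : ℤ) : ∀ᵐ x, ‖f x - polyFun (P k (dyadicIndex k x)) x‖ₑ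
      ≤ (⨆ N, maxCubeDiff P k N x) + polyConst n m * polySharp m f x := by
  have hfm := hf.aestronglyMeasurable
  filter_upwards [tendsto_laverage_dyadicBall hn hf.locallyIntegrable k] with x hx
  have hC := polyConst_ne_top n m
  have hlim : Filter.Tendsto (fun N : ℕ => (⨆ N, maxCubeDiff P k N x) +
      polyConst n m * (⨍⁻ y in dyadicBall (k + N) (dyadicIndex (k + N) x),
        ‖f y - f x‖ₑ ∂volume + polySharp m f x)) Filter.atTop
      (nhds ((⨆ N, maxCubeDiff P k N x) + polyConst n m * (0 + polySharp m f x))) :=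
    (ENNReal.Tendsto.const_mul (hx.add tendsto_const_nhds) (Or.inr hC)).const_add _
  rw [zero_add] at hlim
  refine ge_of_tendsto' hlim fun N => ?_
  have hr := dyadicBall_radius_pos hn (k + N)
  have hxB := mem_dyadicBall hn (k + N) x
  have hc : (MvPolynomial.C (f x) : MvPolynomial (Fin n) ℂ).totalDegree < m := by
    rw [MvPolynomial.totalDegree_C]; omega
  have hpc : ∀ y, polyFun (MvPolynomial.C (f x) : MvPolynomial (Fin n) ℂ) y = f x := fun y => by
    simp [polyFun]
  have h1 := enorm_polyFun_sub_le hfm hc (hP (k + N) (dyadicIndex (k + N) x)).1 hr hxB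
  simp only [hpc] at h1
  calc ‖f x - polyFun (P k (dyadicIndex k x)) x‖ₑ
      ≤ ‖polyFun (P (k + N) (dyadicIndex (k + N) x)) x - polyFun (P k (dyadicIndex k x)) x‖ₑ
        + ‖f x - polyFun (P (k + N) (dyadicIndex (k + N) x)) x‖ₑ := by
        rw [← sub_add_sub_cancel (f x) (polyFun (P (k + N) (dyadicIndex (k + N) x)) x), add_comm]
        exact enorm_add_le _ _
    _ ≤ _ := by
        refine add_le_add ?_ (h1.trans ?_)
        · refine le_iSup_of_le N (le_trans ?_ (cubeDiff_le_maxCubeDiff k le_rfl x))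
          exact le_iSup₂_of_le x rfl le_rfl
        · refine mul_le_mul_right (add_le_add le_rfl ?_) _
          exact (hP _ _).laverage_le_polySharp hfm hr hxB

/-- The `L^p` bound for `f` minus its piecewise polynomial approximation of generation `k`,
uniformly in `k`. -/
theorem exists_lintegral_sub_dyadicApprox_rpow_le (hn : 1 ≤ n) (hm : 1 ≤ m) {p : ℝ} (hp : 1 < p) :
    ∃ C : ℝ≥0∞, C ≠ ∞ ∧
    ∀ (f : EuclideanSpace ℝ (Fin n) → ℂ) (P : ℤ → (Fin n → ℤ) → MvPolynomial (Fin n) ℂ),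
      IsL2Loc f → IsDyadicApprox m f P → ∫⁻ x, polySharp m f x ^ p ≠ ∞ →
      ∀ k : ℤ, ∫⁻ x, ‖f x - polyFun (P k (dyadicIndex k x)) x‖ₑ ^ p
        ≤ C * ∫⁻ x, polySharp m f x ^ p := by
  have hp0 : 0 < p := by linarith
  obtain ⟨C, hC, hmax⟩ := exists_lintegral_maxCubeDiff_rpow_le m hn hp
  refine ⟨2 ^ (p - 1) * (C + polyConst n m ^ p), ENNReal.mul_ne_top
    (ENNReal.rpow_ne_top_of_nonneg (by linarith) (by simp)) (ENNReal.add_ne_top.2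
      ⟨hC, ENNReal.rpow_ne_top_of_nonneg hp0.le (polyConst_ne_top n m)⟩), ?_⟩
  intro f P hf hP hfin k
  have hsup : ∫⁻ x, (⨆ N, maxCubeDiff P k N x) ^ p ≤ C * ∫⁻ x, polySharp m f x ^ p := by
    have h1 : ∀ x, (⨆ N, maxCubeDiff P k N x) ^ p = ⨆ N, maxCubeDiff P k N x ^ p := fun x =>
      (ENNReal.orderIsoRpow p hp0).map_iSup _
    simp_rw [h1]
    rw [lintegral_iSup (fun N => (measurable_maxCubeDiff k N).pow_const p)
      (fun i j hij x => ENNReal.rpow_le_rpow (monotone_maxCubeDiff k x hij) hp0.le)]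
    exact iSup_le fun N => hmax f P hf.aestronglyMeasurable hP hfin k N
  have hmeas := measurable_polySharp m f
  calc ∫⁻ x, ‖f x - polyFun (P k (dyadicIndex k x)) x‖ₑ ^ p
      ≤ ∫⁻ x, 2 ^ (p - 1) * ((⨆ N, maxCubeDiff P k N x) ^ p
          + polyConst n m ^ p * polySharp m f x ^ p) := by
        refine lintegral_mono_ae ((ae_enorm_sub_le hn hm hf hP k).mono fun x hx => ?_)
        rw [← ENNReal.mul_rpow_of_nonneg _ _ hp0.le]
        exact (ENNReal.rpow_le_rpow hx hp0.le).trans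
          (ENNReal.rpow_add_le_mul_rpow_add_rpow _ _ hp.le)
    _ = 2 ^ (p - 1) * ((∫⁻ x, (⨆ N, maxCubeDiff P k N x) ^ p)
          + polyConst n m ^ p * ∫⁻ x, polySharp m f x ^ p) := by
        rw [lintegral_const_mul' _ _ (ENNReal.rpow_ne_top_of_nonneg (by linarith) (by simp)),
          lintegral_add_right _ (by fun_prop), lintegral_const_mul _ (by fun_prop)]
    _ ≤ _ := by
        rw [mul_assoc, add_mul]
        gcongr

end DyadicApproximation

/-! ### Passage to a global polynomial, converse bound, uniqueness -/

section GlobalApproximation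

variable {n m : ℕ} {f : EuclideanSpace ℝ (Fin n) → ℂ}

theorem exists_isDyadicApprox (hm : 1 ≤ m) (hf : IsL2Loc f) : ∃ P, IsDyadicApprox m f P := by
  choose P hP using fun (k : ℤ) (z : Fin n → ℤ) => exists_laverage_le_polyOscillation hm
    (hf.memLp_ball (dyadicCorner k z) (3 * n * (2 : ℝ) ^ (-k)))
  exact ⟨P, hP⟩

theorem mul_rpow_le_lintegral_of_forall_le {F : EuclideanSpace ℝ (Fin n) → ℝ≥0∞} {p : ℝ}
    (hp : 0 < p) {a : ℝ≥0∞} {c : EuclideanSpace ℝ (Fin n)} {r : ℝ}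
    (h : ∀ x ∈ Metric.ball c r, a ≤ F x) :
    a ^ p * volume (Metric.ball c r) ≤ ∫⁻ x, F x ^ p := by
  rw [← setLIntegral_const]
  exact (setLIntegral_mono' measurableSet_ball fun x hx => ENNReal.rpow_le_rpow (h x hx) hp.le).trans
    (setLIntegral_le_lintegral _ _)

/-- The decay rate of the oscillation over balls of volume at least `2ᵏ |B(0, 1)|`. -/
noncomputable def oscDecay (p : ℝ) (m : ℕ) (f : EuclideanSpace ℝ (Fin n) → ℂ) (k : ℕ) : ℝ≥0∞ :=
  ((∫⁻ x, polySharp m f x ^ p) / volume (Metric.ball (0 : EuclideanSpace ℝ (Fin n)) 1)) ^ (1 / p)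
    * (2⁻¹ ^ (1 / p)) ^ k

theorem half_rpow_lt_one {p : ℝ} (hp : 0 < p) : (2⁻¹ : ℝ≥0∞) ^ (1 / p) < 1 :=
  ENNReal.rpow_lt_one ENNReal.one_half_lt_one (by positivity)

theorem oscDecay_const_ne_top {p : ℝ} (hp : 0 < p) (hfin : ∫⁻ x, polySharp m f x ^ p ≠ ∞) :
    ((∫⁻ x, polySharp m f x ^ p) / volume (Metric.ball (0 : EuclideanSpace ℝ (Fin n)) 1)) ^ (1 / p)
      ≠ ∞ :=
  ENNReal.rpow_ne_top_of_nonneg (by positivity)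
    (ENNReal.div_ne_top hfin (volume_ball_ne_zero _ one_pos))

theorem tsum_oscDecay_ne_top {p : ℝ} (hp : 0 < p) (hfin : ∫⁻ x, polySharp m f x ^ p ≠ ∞) :
    ∑' k, oscDecay p m f k ≠ ∞ := by
  unfold oscDecay
  rw [ENNReal.tsum_mul_left, ENNReal.tsum_geometric]
  refine ENNReal.mul_ne_top (oscDecay_const_ne_top hp hfin) (ENNReal.inv_ne_top.2 ?_)
  exact (tsub_pos_of_lt (half_rpow_lt_one hp)).ne'

theorem tendsto_oscDecay {p : ℝ} (hp : 0 < p) (hfin : ∫⁻ x, polySharp m f x ^ p ≠ ∞) :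
    Filter.Tendsto (oscDecay p m f) Filter.atTop (nhds 0) :=
  ENNReal.tendsto_atTop_zero_of_tsum_ne_top (tsum_oscDecay_ne_top hp hfin)

/-- The sharp function is at least the oscillation on the whole ball, so the `p`-th power of the
oscillation times the volume is at most the integral of `(f^#)^p`. -/
theorem polyOscillation_le_oscDecay {p : ℝ} (hp : 0 < p) {c : EuclideanSpace ℝ (Fin n)} {r : ℝ}
    (hr : 0 < r) {k : ℕ} (hk : 2 ^ k ≤ r ^ n) : polyOscillation m f c r ≤ oscDecay p m f k := by
  have h := mul_rpow_le_lintegral_of_forall_le hp (c := c) (r := r) (F := polySharp m f)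
    fun x hx => polyOscillation_le_polySharp (f := f) (m := m) hr hx
  set H := ∫⁻ x, polySharp m f x ^ p
  set V := volume (Metric.ball (0 : EuclideanSpace ℝ (Fin n)) 1) with hV
  have hV0 : V ≠ 0 := volume_ball_ne_zero _ one_pos
  have hVt : V ≠ ∞ := volume_ball_ne_top _ _
  have h2 : (2 : ℝ≥0∞) ^ k ≤ ENNReal.ofReal (r ^ n) := by
    rw [← ENNReal.ofReal_ofNat, ← ENNReal.ofReal_pow (by norm_num)]
    exact ENNReal.ofReal_le_ofReal hk
  have h3 : polyOscillation m f c r ^ p ≤ H / V * 2⁻¹ ^ k := by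
    rw [← ENNReal.inv_pow, ← div_eq_mul_inv, ENNReal.le_div_iff_mul_le (by simp) (by simp),
      ENNReal.le_div_iff_mul_le (Or.inl hV0) (Or.inl hVt), mul_assoc]
    refine le_trans ?_ h
    rw [volume_ball_eq c hr]
    gcongr
  have h4 : oscDecay p m f k = (H / V * 2⁻¹ ^ k) ^ (1 / p) := by
    rw [ENNReal.mul_rpow_of_nonneg _ _ (by positivity), oscDecay, ← ENNReal.rpow_natCast,
      ← ENNReal.rpow_natCast, ← ENNReal.rpow_mul, ← ENNReal.rpow_mul, mul_comm (k : ℝ)]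
  rw [h4, one_div, ENNReal.le_rpow_inv_iff hp]
  exact h3

/-- Used with `κ = 2` for consecutive balls about the origin, and with `κ = 3` for a dyadic ball
inside one of these. -/
theorem IsBestApprox.enorm_sub_le_oscDecay (hf : AEStronglyMeasurable f volume) {p : ℝ} (hp : 0 < p)
    {c c' y : EuclideanSpace ℝ (Fin n)} {r κ : ℝ} (hr : 0 < r) (hκ : 0 < κ)
    (hsub : Metric.ball c r ⊆ Metric.ball c' (κ * r)) {k : ℕ} (hk : 2 ^ k ≤ r ^ n)
    (hk' : 2 ^ k ≤ (κ * r) ^ n) {P P' : MvPolynomial (Fin n) ℂ} (hP : IsBestApprox m f c r P)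
    (hP' : IsBestApprox m f c' (κ * r) P') (hy : y ∈ Metric.ball c r) :
    ‖polyFun P y - polyFun P' y‖ₑ
      ≤ polyConst n m * (1 + ENNReal.ofReal (κ ^ n)) * oscDecay p m f k := by
  have hκr : 0 < κ * r := mul_pos hκ hr
  have havg : ∀ {c : EuclideanSpace ℝ (Fin n)} {r : ℝ} {P : MvPolynomial (Fin n) ℂ}, 0 < r →
      2 ^ k ≤ r ^ n → IsBestApprox m f c r P →
      ⨍⁻ z in Metric.ball c r, ‖f z - polyFun P z‖ₑ ∂volume ≤ oscDecay p m f k := by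
    intro c r P hr hk hP
    exact (setLAverage_le_rpow (aemeasurable_enorm_sub_polyFun hf P).restrict
      (volume_ball_ne_zero c hr) (volume_ball_ne_top c r)).trans
      (hP.2.trans (polyOscillation_le_oscDecay hp hr hk))
  refine (enorm_polyFun_sub_le hf hP.1 hP'.1 hr hy).trans ?_
  rw [mul_assoc, add_mul, one_mul]
  gcongr
  · exact havg hr hk hP
  · refine (setLAverage_le_mul_of_subset hsub (volume_ball_ne_zero _ hr) (volume_ball_ne_top _ _)
      (volume_ball_mul c' c hr hκ).le _).trans ?_
    gcongr
    exact havg hκr hk' hP'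

/-- The piecewise polynomial approximations of generation `-k` converge pointwise, as `k → ∞`, to
a single polynomial. -/
theorem exists_tendsto_dyadicApprox (hn : 1 ≤ n) (hm : 1 ≤ m) {p : ℝ} (hp : 0 < p) (hf : IsL2Loc f)
    (hfin : ∫⁻ x, polySharp m f x ^ p ≠ ∞) {P : ℤ → (Fin n → ℤ) → MvPolynomial (Fin n) ℂ}
    (hP : IsDyadicApprox m f P) :
    ∃ Q : MvPolynomial (Fin n) ℂ, Q.totalDegree < m ∧
      ∀ x, Filter.Tendsto (fun k : ℕ => polyFun (P (-k) (dyadicIndex (-k) x)) x)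
        Filter.atTop (nhds (polyFun Q x)) := by
  have hfm := hf.aestronglyMeasurable
  have hn' : (1 : ℝ) ≤ n := by exact_mod_cast hn
  -- Three times the radius of the dyadic balls of generation `-k`, so that `B(0, R k)` contains the
  -- one around `x` once `2 ^ k ≥ ‖x‖`.
  let R : ℕ → ℝ := fun k => 3 * (3 * n * 2 ^ k)
  have hR : ∀ k, 0 < R k := fun k => by positivity
  have hpow : ∀ (k : ℕ) (a : ℝ), 1 ≤ a → (2 : ℝ) ^ k ≤ (a * 2 ^ k) ^ n := fun k a ha => by
    have h1 : (1 : ℝ) ≤ 2 ^ k := one_le_pow₀ one_le_two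
    have h2 : (2 : ℝ) ^ k ≤ a * 2 ^ k := le_mul_of_one_le_left (by positivity) ha
    exact h2.trans (le_self_pow₀ (h1.trans h2) (by omega))
  have hRpow : ∀ k, (2 : ℝ) ^ k ≤ R k ^ n := fun k => by
    have := hpow k (9 * n) (by linarith)
    convert this using 2
    simp only [R]; ring
  choose Q hQ using fun k => exists_laverage_le_polyOscillation hm (hf.memLp_ball 0 (R k))
  have hQ : ∀ k, IsBestApprox m f 0 (R k) (Q k) := hQ
  have hR2 : ∀ k, R (k + 1) = 2 * R k := fun k => by simp only [R, pow_succ]; ring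
  have hstep : ∀ k, ∀ y ∈ Metric.ball (0 : EuclideanSpace ℝ (Fin n)) 1,
      ‖polyFun (Q (k + 1) - Q k) y‖ₑ
        ≤ polyConst n m * (1 + ENNReal.ofReal (2 ^ n)) * oscDecay p m f k := by
    intro k y hy
    rw [polyFun_sub, enorm_sub_rev]
    have h1 : (1 : ℝ) ≤ 2 ^ k := one_le_pow₀ one_le_two
    have hR1 : 1 ≤ R k := by
      simp only [R]
      nlinarith
    refine (hQ k).enorm_sub_le_oscDecay hfm hp (hR k) two_pos
      (Metric.ball_subset_ball (by linarith [hR k])) (hRpow k) ?_ (hR2 k ▸ hQ (k + 1))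
      (Metric.ball_subset_ball hR1 hy)
    rw [← hR2]
    exact (pow_le_pow_right₀ one_le_two k.le_succ).trans (hRpow (k + 1))
  have hDt : ∀ κ : ℝ, polyConst n m * (1 + ENNReal.ofReal (κ ^ n)) ≠ ∞ := fun κ =>
    ENNReal.mul_ne_top (polyConst_ne_top n m) (by finiteness)
  obtain ⟨L, hL, hlim⟩ := exists_tendsto_polyFun Q (fun k => (hQ k).1) (by
    refine ne_top_of_le_ne_top (b := ∑' k, polyConst n m * (1 + ENNReal.ofReal (2 ^ n))
      * oscDecay p m f k * volume (Metric.ball (0 : EuclideanSpace ℝ (Fin n)) 1)) ?_ ?_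
    · rw [ENNReal.tsum_mul_right, ENNReal.tsum_mul_left]
      exact ENNReal.mul_ne_top (ENNReal.mul_ne_top (hDt 2) (tsum_oscDecay_ne_top hp hfin))
        (volume_ball_ne_top _ _)
    · refine ENNReal.tsum_le_tsum fun k => ?_
      rw [← setLIntegral_const]
      exact setLIntegral_mono' measurableSet_ball (hstep k))
  refine ⟨L, hL, fun x => ?_⟩
  have hclose : Filter.Tendsto (fun k : ℕ =>
      polyFun (P (-k) (dyadicIndex (-k) x)) x - polyFun (Q k) x) Filter.atTop (nhds 0) := by
    rw [tendsto_zero_iff_enorm_tendsto_zero]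
    have hz : Filter.Tendsto (fun k => polyConst n m * (1 + ENNReal.ofReal (3 ^ n))
        * oscDecay p m f k) Filter.atTop (nhds 0) := by
      have := ENNReal.Tendsto.const_mul (tendsto_oscDecay hp hfin) (Or.inr (hDt 3))
      rwa [mul_zero] at this
    have hev : ∀ᶠ k : ℕ in Filter.atTop, ‖x‖ ≤ 2 ^ k :=
      (tendsto_pow_atTop_atTop_of_one_lt one_lt_two).eventually_ge_atTop ‖x‖
    refine tendsto_of_tendsto_of_tendsto_of_le_of_le' tendsto_const_nhds hz
      (Filter.Eventually.of_forall fun _ => zero_le) (hev.mono fun k hk => ?_)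
    have hr := dyadicBall_radius_pos hn (-k : ℤ)
    have hrad : (2 : ℝ) ^ (-(-k : ℤ)) = 2 ^ k := by rw [neg_neg, zpow_natCast]
    have hRk : R k = 3 * (3 * n * (2 : ℝ) ^ (-(-k : ℤ))) := by rw [hrad]
    refine (hP (-k) (dyadicIndex (-k) x)).enorm_sub_le_oscDecay hfm hp hr three_pos ?_ ?_ ?_
      (hRk ▸ hQ k) (mem_dyadicBall hn (-k) x)
    · intro y hy
      have h1 : dist y (dyadicCorner (-k) (dyadicIndex (-k) x)) < 3 * n * (2 : ℝ) ^ (-(-k : ℤ)) := hy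
      have h2 := dist_dyadicCorner_le (-k) x
      rw [hrad] at h1 h2
      rw [← hRk, mem_ball_zero_iff, ← dist_zero_right]
      rw [← dist_zero_right] at hk
      rw [dist_comm] at h2
      have h3 : (2 : ℝ) ^ k ≤ n * 2 ^ k := le_mul_of_one_le_left (by positivity) hn'
      have h4 : (0 : ℝ) < 2 ^ k := by positivity
      simp only [R]
      linarith [dist_triangle y (dyadicCorner (-k) (dyadicIndex (-k) x)) 0,
        dist_triangle (dyadicCorner (-k) (dyadicIndex (-k) x)) x 0]
    · rw [hrad]
      exact hpow k (3 * n) (by linarith)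
    · rw [← hRk]
      exact hRpow k
  have := hclose.add (hlim x)
  simpa using this

theorem measurable_polyFun_dyadicIndex (P : ℤ → (Fin n → ℤ) → MvPolynomial (Fin n) ℂ) (k : ℤ) :
    Measurable fun x : EuclideanSpace ℝ (Fin n) => polyFun (P k (dyadicIndex k x)) x := by
  let F : (Fin n → ℤ) × EuclideanSpace ℝ (Fin n) → ℂ := fun z => polyFun (P k z.1) z.2
  have hF : Measurable F :=
    measurable_from_prod_countable_right fun z => (continuous_polyFun (P k z)).measurable
  exact (hF.comp ((measurable_dyadicIndex k).prodMk measurable_id) :)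

/-- The bound of generation `-k` is uniform in `k`, so Fatou's lemma carries it to the limit
polynomial. -/
theorem exists_lintegral_sub_polyFun_rpow_le (hn : 1 ≤ n) (hm : 1 ≤ m) {p : ℝ} (hp : 1 < p) :
    ∃ C : ℝ≥0∞, C ≠ ∞ ∧ ∀ f : EuclideanSpace ℝ (Fin n) → ℂ, IsL2Loc f →
      ∫⁻ x, polySharp m f x ^ p ≠ ∞ → ∃ P : MvPolynomial (Fin n) ℂ, P.totalDegree < m ∧
        ∫⁻ x, ‖f x - polyFun P x‖ₑ ^ p ≤ C * ∫⁻ x, polySharp m f x ^ p := by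
  have hp0 : 0 < p := by linarith
  obtain ⟨C, hC, hbound⟩ := exists_lintegral_sub_dyadicApprox_rpow_le hn hm hp
  refine ⟨C, hC, fun f hf hfin => ?_⟩
  obtain ⟨P, hP⟩ := exists_isDyadicApprox hm hf
  obtain ⟨Q, hQ, hlim⟩ := exists_tendsto_dyadicApprox hn hm hp0 hf hfin hP
  refine ⟨Q, hQ, ?_⟩
  have hliminf : ∀ x, Filter.liminf
      (fun k : ℕ => ‖f x - polyFun (P (-k) (dyadicIndex (-k) x)) x‖ₑ ^ p) Filter.atTop
      = ‖f x - polyFun Q x‖ₑ ^ p := fun x =>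
    (((ENNReal.continuous_rpow_const (y := p)).tendsto _).comp
      ((continuous_enorm.tendsto _).comp ((hlim x).const_sub (f x)))).liminf_eq
  simp_rw [← hliminf]
  refine (lintegral_liminf_le' fun k => ?_).trans ?_
  · exact ((hf.aestronglyMeasurable.aemeasurable.sub
      (measurable_polyFun_dyadicIndex P (-k)).aemeasurable).enorm).pow_const p
  · refine Filter.liminf_le_of_frequently_le' (Filter.Frequently.of_forall fun k => ?_)
    exact hbound f P hf hP hfin (-k)

/-- The condition `p > 2` enters only here: the maximal inequality is applied to `|f - P|²` with
exponent `p / 2`. -/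
theorem exists_lintegral_polySharp_rpow_le (m : ℕ) (hn : 1 ≤ n) {p : ℝ} (hp : 2 < p) :
    ∃ C : ℝ≥0∞, C ≠ ∞ ∧ ∀ (f : EuclideanSpace ℝ (Fin n) → ℂ) (P : MvPolynomial (Fin n) ℂ),
      AEStronglyMeasurable f volume → P.totalDegree < m →
      ∫⁻ x, polySharp m f x ^ p ≤ C * ∫⁻ x, ‖f x - polyFun P x‖ₑ ^ p := by
  obtain ⟨C, hC, hmax⟩ := exists_lintegral_maximalFn_rpow_le hn (q := p / 2) (by linarith)
  refine ⟨C, hC, fun f P hf hP => ?_⟩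
  have hsq : ∀ a : ℝ≥0∞, (a ^ 2) ^ (p / 2) = a ^ p := fun a => by
    rw [← ENNReal.rpow_natCast, ← ENNReal.rpow_mul]
    congr 1
    push_cast
    ring
  have h := hmax (fun y => ‖f y - polyFun P y‖ₑ ^ 2)
    ((aemeasurable_enorm_sub_polyFun hf P).pow_const 2)
  simp_rw [hsq] at h
  refine le_trans (lintegral_mono fun x => ?_) h
  have h1 : polySharp m f x ≤ maximalFn (fun y => ‖f y - polyFun P y‖ₑ ^ 2) x ^ (1 / 2 : ℝ) := by
    refine iSup₂_le fun c r => iSup₂_le fun hr hx => (iInf₂_le P hP).trans ?_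
    exact ENNReal.rpow_le_rpow
      (laverage_ball_le_maximalFn (fun y => ‖f y - polyFun P y‖ₑ ^ 2) hr hx) (by norm_num)
  refine (ENNReal.rpow_le_rpow h1 (by linarith)).trans (le_of_eq ?_)
  rw [← ENNReal.rpow_mul]
  congr 1
  ring

/-- For `y` in the unit ball and `r ≥ 1`, `|P y|` is at most a constant times the mean of `|P|` over
`B(0, r)`, hence times its maximal function at each point of that ball. So `|P y| ^ p` times the
volume of `B(0, r)` is bounded in `r`, forcing `P y = 0`. -/
theorem eq_zero_of_lintegral_polyFun_rpow_ne_top (hn : 1 ≤ n) {p : ℝ} (hp : 1 < p)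
    {P : MvPolynomial (Fin n) ℂ} (hfin : ∫⁻ x, ‖polyFun P x‖ₑ ^ p ≠ ∞) : P = 0 := by
  have hp0 : 0 < p := by linarith
  obtain ⟨C, hC, hmax⟩ := exists_lintegral_maximalFn_rpow_le hn hp
  have hM := hmax (fun y => ‖polyFun P y‖ₑ) (continuous_polyFun P).measurable.enorm.aemeasurable
  set I := ∫⁻ x, maximalFn (fun y => ‖polyFun P y‖ₑ) x ^ p with hI
  have hIt : I ≠ ∞ := ne_top_of_le_ne_top (ENNReal.mul_ne_top hC hfin) hM
  set D := polyConst n (P.totalDegree + 1)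
  have hDt : D ^ p ≠ ∞ := ENNReal.rpow_ne_top_of_nonneg hp0.le (polyConst_ne_top _ _)
  refine eq_zero_of_polyFun_eq_zero_on_ball (c := 0) one_pos fun y hy => ?_
  have hle : ∀ r : ℝ, 1 ≤ r →
      ‖polyFun P y‖ₑ ^ p * volume (Metric.ball (0 : EuclideanSpace ℝ (Fin n)) r) ≤ D ^ p * I := by
    intro r hr
    have hr0 : 0 < r := by linarith
    have h1 := enorm_polyFun_le_laverage (P.totalDegree.lt_succ_self) hr0
      (Metric.ball_subset_ball hr hy)
    have h2 := mul_rpow_le_lintegral_of_forall_le hp0 fun x hx =>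
      laverage_ball_le_maximalFn (fun y => ‖polyFun P y‖ₑ) (c := 0) hr0 hx
    calc _ ≤ (D * ⨍⁻ z in Metric.ball 0 r, ‖polyFun P z‖ₑ ∂volume) ^ p
            * volume (Metric.ball (0 : EuclideanSpace ℝ (Fin n)) r) := by gcongr
      _ = D ^ p * ((⨍⁻ z in Metric.ball 0 r, ‖polyFun P z‖ₑ ∂volume) ^ p
            * volume (Metric.ball (0 : EuclideanSpace ℝ (Fin n)) r)) := by
          rw [ENNReal.mul_rpow_of_nonneg _ _ hp0.le, mul_assoc]
      _ ≤ _ := by gcongr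
  by_contra hne
  set V := volume (Metric.ball (0 : EuclideanSpace ℝ (Fin n)) 1)
  have ha0 : ‖polyFun P y‖ₑ ^ p * V ≠ 0 :=
    mul_ne_zero (ENNReal.rpow_pos (pos_iff_ne_zero.2 (enorm_ne_zero.2 hne)) enorm_ne_top).ne'
      (volume_ball_ne_zero _ one_pos)
  obtain ⟨N, hN⟩ := ENNReal.exists_nat_mul_gt ha0 (ENNReal.mul_ne_top hDt hIt)
  have hN1 : (N : ℝ≥0∞) ≤ ENNReal.ofReal ((N + 1 : ℝ) ^ n) := by
    rw [← ENNReal.ofReal_natCast]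
    refine ENNReal.ofReal_le_ofReal ((le_add_of_nonneg_right zero_le_one).trans ?_)
    exact le_self_pow₀ (le_add_of_nonneg_left N.cast_nonneg) (by omega)
  have h := hle (N + 1) (le_add_of_nonneg_left N.cast_nonneg)
  rw [volume_ball_eq _ (by positivity : (0 : ℝ) < N + 1), mul_left_comm] at h
  exact absurd (hN.trans_le ((mul_le_mul_left hN1 _).trans h)) (lt_irrefl _)

end GlobalApproximation

/-! ### The norm equivalence -/

theorem proposition2p6 (n m : ℕ) (hn : 1 ≤ n) (hm : 1 ≤ m) (p : ℝ) (hp : 2 < p) :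
    ∃ C : ℝ, 0 < C ∧
      ∀ f : EuclideanSpace ℝ (Fin n) → ℂ, MemPolyLp p m f →
        ∃ P : MvPolynomial (Fin n) ℂ,
          (P.totalDegree < m ∧
            MemLp (fun x => f x - polyFun P x) (ENNReal.ofReal p) volume) ∧
          (∀ Q : MvPolynomial (Fin n) ℂ, Q.totalDegree < m →
            MemLp (fun x => f x - polyFun Q x) (ENNReal.ofReal p) volume → Q = P) ∧
          ENNReal.ofReal C⁻¹ * polyLpNorm p m f
            ≤ eLpNorm (fun x => f x - polyFun P x) (ENNReal.ofReal p) volume ∧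
          eLpNorm (fun x => f x - polyFun P x) (ENNReal.ofReal p) volume
            ≤ ENNReal.ofReal C * polyLpNorm p m f := by
  have hp0 : 0 < p := by linarith
  have hp1 : 1 < p := by linarith
  have hpinv : 0 ≤ 1 / p := by positivity
  obtain ⟨C₁, hC₁, hupper⟩ := exists_lintegral_sub_polyFun_rpow_le hn hm hp1
  obtain ⟨C₂, hC₂, hlower⟩ := exists_lintegral_polySharp_rpow_le m hn hp
  have hD₁ : C₁ ^ (1 / p) ≠ ∞ := ENNReal.rpow_ne_top_of_nonneg hpinv hC₁
  have hD₂ : C₂ ^ (1 / p) ≠ ∞ := ENNReal.rpow_ne_top_of_nonneg hpinv hC₂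
  -- The sum dominates both constants; the extra `1` only secures positivity.
  set C : ℝ := (C₁ ^ (1 / p)).toReal + (C₂ ^ (1 / p)).toReal + 1 with hC
  have hC0 : 0 < C := by positivity
  have hCC₁ : C₁ ^ (1 / p) ≤ ENNReal.ofReal C := by
    rw [ENNReal.le_ofReal_iff_toReal_le hD₁ hC0.le, hC]
    linarith [ENNReal.toReal_nonneg (a := C₂ ^ (1 / p))]
  have hCC₂ : C₂ ^ (1 / p) ≤ ENNReal.ofReal C := by
    rw [ENNReal.le_ofReal_iff_toReal_le hD₂ hC0.le, hC]
    linarith [ENNReal.toReal_nonneg (a := C₁ ^ (1 / p))]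
  have hnorm : ∀ g : EuclideanSpace ℝ (Fin n) → ℂ,
      eLpNorm g (ENNReal.ofReal p) volume = (∫⁻ x, ‖g x‖ₑ ^ p) ^ (1 / p) := fun g => by
    rw [eLpNorm_eq_lintegral_rpow_enorm_toReal (by simpa using hp0) ENNReal.ofReal_ne_top,
      ENNReal.toReal_ofReal hp0.le]
  have hnorm' : ∀ f : EuclideanSpace ℝ (Fin n) → ℂ,
      polyLpNorm p m f = (∫⁻ x, polySharp m f x ^ p) ^ (1 / p) := fun f => by
    rw [polyLpNorm, eLpNorm_eq_lintegral_rpow_enorm_toReal (by simpa using hp0)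
      ENNReal.ofReal_ne_top, ENNReal.toReal_ofReal hp0.le]
    simp
  refine ⟨C, hC0, fun f hf => ?_⟩
  have hfm := hf.1.aestronglyMeasurable
  have hfin : ∫⁻ x, polySharp m f x ^ p ≠ ∞ := fun h => by
    have := hf.2
    rw [hnorm', h, ENNReal.top_rpow_of_pos (by positivity)] at this
    exact lt_irrefl _ this
  obtain ⟨P, hP, hle⟩ := hupper f hf.1 hfin
  have hmem : MemLp (fun x => f x - polyFun P x) (ENNReal.ofReal p) volume := by
    refine ⟨hfm.sub (continuous_polyFun P).aestronglyMeasurable, ?_⟩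
    rw [hnorm]
    exact ENNReal.rpow_lt_top_of_nonneg hpinv
      (ne_top_of_le_ne_top (ENNReal.mul_ne_top hC₁ hfin) hle)
  refine ⟨P, ⟨hP, hmem⟩, fun Q hQ hQmem => ?_, ?_, ?_⟩
  · have hdiff := hmem.sub hQmem
    have heq : ((fun x => f x - polyFun P x) - fun x => f x - polyFun Q x) = polyFun (Q - P) := by
      funext x
      simp only [Pi.sub_apply, polyFun_sub]
      ring
    rw [heq] at hdiff
    refine sub_eq_zero.1 (eq_zero_of_lintegral_polyFun_rpow_ne_top hn hp1 fun h => ?_)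
    have := hdiff.2
    rw [hnorm, h, ENNReal.top_rpow_of_pos (by positivity)] at this
    exact lt_irrefl _ this
  · rw [hnorm, hnorm', ENNReal.ofReal_inv_of_pos hC0, mul_comm, ← div_eq_mul_inv]
    refine ENNReal.div_le_of_le_mul' ((ENNReal.rpow_le_rpow (hlower f P hfm hP) hpinv).trans ?_)
    rw [ENNReal.mul_rpow_of_nonneg _ _ hpinv]
    gcongr
  · rw [hnorm, hnorm']
    refine (ENNReal.rpow_le_rpow hle hpinv).trans ?_
    rw [ENNReal.mul_rpow_of_nonneg _ _ hpinv]
    gcongr
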